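/- Let $k\ge 1$ be an integer and $0\le\alpha<1$, and let $\mathbb D=\{z\in\mathbb C:|z|<1\}$. Let $S_{LH}^{k*}(\alpha)$ be the class of univalent mappings $f:\mathbb D\to\mathbb C$ such that: - $f(z)=z\,h(z)\,\overline{g(z)}$ on $\mathbb D$, where $h(z)=\exp\big(\sum_{n\ge1}a_{nk}z^{nk}\big)$ and $g(z)=\exp\big(\sum_{n\ge1}b_{nk}z^{nk}\big)$ are analytic in $\mathbb D$ (the two series converging in $\mathbb D$); - $f$ is $k$-fold symmetric: $f(e^{2\pi i/k}z)=e^{2\pi i/k}f(z)$; - $f$ is logharmonic: $\overline{f_{\bar z}}/\overline{f}=\omega\, f_z/f$ on $\mathbb D\setminus\{0\}$ for some analytic $\omega$ on $\mathbb D$ with $|\omega|<1$ (the second dilatation of $f$); - $f$ is starlike of order $\alpha$: $\operatorname{Re}\dfrac{z f_z(z)-\bar z f_{\bar z}(z)}{f(z)}>\alpha$ for $z\in\mathbb D\setminus\{0\}$. Write $\mathrm{Li}_2(x)=\sum_{n\ge1}x^n/n^2$, and let $d(f(0),\partial f(\mathbb D))$ be the Euclidean distance from $f(0)$ to the boundary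 of $f(\mathbb D)$. **Theorem.** The equation $$\frac{r\,2^{2\alpha/k}}{(1-r^k)^{2\alpha(3-2\alpha)/k}}\exp\left(\frac1k\left[\frac{4(1-\alpha)(2-\alpha)r^k}{1-r^k}+(2\alpha-1)\,\mathrm{Li}_2(r^k)+2(1-\alpha)\right]\right)=1$$ has a unique root $r_1$ in $(0,1)$. For every $f\in S_{LH}^{k*}(\alpha)$ with $\omega(0)=0$ and every real $\theta$, the inequality $$|z|\exp\left(\sum_{n=1}^\infty\left|a_{nk}+e^{i\theta}b_{nk}+k\,a_{nk}b_{nk}\right||z|^{nk}\right)\le d(f(0),\partial f(\mathbb D))$$ holds (the series converging) for $|z|\le r_1$. The radius $r_1$ is best possible: there is $f\in S_{LH}^{k*}(\alpha)$ with $\omega(0)=0$ such that, for $\theta=0$ and every $r\in(r_1,1)$, the inequality fails at some $z$ with $|z|=r$. -/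

import Mathlib

noncomputable section

/-- The open unit disk in the complex plane. -/
def unitDisk : Set ℂ := Metric.ball (0 : ℂ) 1

/-- The Wirtinger derivative `∂f/∂z = (f_x - i f_y) / 2`. -/
def dz (f : ℂ → ℂ) (z : ℂ) : ℂ :=
  (fderiv ℝ f z 1 - Complex.I * fderiv ℝ f z Complex.I) / 2

/-- The Wirtinger derivative `∂f/∂z̄ = (f_x + i f_y) / 2`. -/
def dzbar (f : ℂ → ℂ) (z : ℂ) : ℂ :=
  (fderiv ℝ f z 1 + Complex.I * fderiv ℝ f z Complex.I) / 2

/-- `f` is logharmonic in the unit disk with second dilatation `ω`: `ω` is analytic with `|ω| < 1`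
and `conj (f_z̄) / conj f = ω * (f_z / f)` (at all points where the quotients make sense). -/
structure IsLogharmonic (f ω : ℂ → ℂ) : Prop where
  analytic_dilatation : DifferentiableOn ℂ ω unitDisk
  dilatation_lt_one : ∀ z ∈ unitDisk, ‖ω z‖ < 1
  differentiable : DifferentiableOn ℝ f unitDisk
  equation : ∀ z ∈ unitDisk, f z ≠ 0 →
    starRingEnd ℂ (dzbar f z) / starRingEnd ℂ (f z) = ω z * (dz f z / f z)

/-- `f` is `k`-fold symmetric in the unit disk. -/
def IsKFoldSymmetric (k : ℕ) (f : ℂ → ℂ) : Prop :=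
  ∀ z ∈ unitDisk, f (Complex.exp (2 * Real.pi * Complex.I / k) * z) =
    Complex.exp (2 * Real.pi * Complex.I / k) * f z

/-- Starlikeness of order `α`: `Re (D f / f) > α` with `D = z ∂/∂z - z̄ ∂/∂z̄`. The maps considered
vanish exactly at the origin, where the quotient is not defined. -/
def IsStarlikeOfOrder (α : ℝ) (f : ℂ → ℂ) : Prop :=
  ∀ z ∈ unitDisk, z ≠ 0 →
    α < ((z * dz f z - starRingEnd ℂ z * dzbar f z) / f z).re

/-- `h(z) = exp (∑_{n ≥ 1} a_{nk} z^{nk})` in the unit disk, where the series converges. -/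
def IsExpSeries (k : ℕ) (a : ℕ → ℂ) (h : ℂ → ℂ) : Prop :=
  ∀ z ∈ unitDisk, Summable (fun n : ℕ => a ((n + 1) * k) * z ^ ((n + 1) * k)) ∧
    h z = Complex.exp (∑' n : ℕ, a ((n + 1) * k) * z ^ ((n + 1) * k))

/-- `f = z h conj(g)` belongs to the class of univalent `k`-fold symmetric logharmonic mappings
of the unit disk, starlike of order `α`, with second dilatation `ω` and with coefficients
`a_{nk}`, `b_{nk}` (`n ≥ 1`) of `log h` and `log g`. -/
structure IsStarlikeLogharmonic (k : ℕ) (α : ℝ) (f ω h g : ℂ → ℂ) (a b : ℕ → ℂ) : Prop where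
  univalent : Set.InjOn f unitDisk
  logharmonic : IsLogharmonic f ω
  symmetric : IsKFoldSymmetric k f
  starlike : IsStarlikeOfOrder α f
  analytic_h : DifferentiableOn ℂ h unitDisk
  analytic_g : DifferentiableOn ℂ g unitDisk
  factorization : ∀ z ∈ unitDisk, f z = z * h z * starRingEnd ℂ (g z)
  series_h : IsExpSeries k a h
  series_g : IsExpSeries k b g

/-- The dilogarithm `Li₂(x) = ∑_{n ≥ 1} x^n / n^2` (for `|x| ≤ 1`, where the series converges). -/
def dilog (x : ℝ) : ℝ := ∑' n : ℕ, x ^ (n + 1) / ((n : ℝ) + 1) ^ 2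

/-- The distance `d(f(0), ∂f(𝔻))`. -/
def boundaryDist (f : ℂ → ℂ) : ℝ := Metric.infDist (f 0) (frontier (f '' unitDisk))

/-- The term with index `n + 1` of the series
`∑_{n ≥ 1} |a_{nk} + e^{iθ} b_{nk} + k a_{nk} b_{nk}| |z|^{nk}`. -/
def bohrTerm (k : ℕ) (θ : ℝ) (a b : ℕ → ℂ) (z : ℂ) (n : ℕ) : ℝ :=
  ‖a ((n + 1) * k) + Complex.exp (Complex.I * θ) * b ((n + 1) * k) +
    k * a ((n + 1) * k) * b ((n + 1) * k)‖ * ‖z‖ ^ ((n + 1) * k)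

/-- The left-hand side of the equation that defines the radius. -/
def radiusFun (k : ℕ) (α r : ℝ) : ℝ :=
  r * (2 : ℝ) ^ (2 * α / k) / (1 - r ^ k) ^ (2 * α * (3 - 2 * α) / k) *
    Real.exp ((4 * (1 - α) * (2 - α) * r ^ k / (1 - r ^ k) + (2 * α - 1) * dilog (r ^ k) +
      2 * (1 - α)) * (1 / k))

end

noncomputable section

/-! With `ζ = z^k` and `A = k log h`, `B = k log g` read as functions of `ζ`, every map of the class
is `z exp(A(ζ)/k) conj(exp(B(ζ)/k))`, where `ζB' = W(1 + ζA')`, `|W| < 1`, and `P = 1 + ζA' - ζB'`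
has real part above `α` (`IsStarlikeLogharmonic.exists_isLogPair`). Put `Q = (1 + W)/(1 - W)`, which
has positive real part and `Q(0) = 1`. Everything rests on two identities: `ζB' = ((Q - 1)/2) P` and
`1 + ζ(A' + B') = P Q`.

Carathéodory's inequality for `P` and `Q`, fed into the first identity, bounds the coefficients of
`B` and then of `A` (`coeff_B_le`, `coeff_A_le`). If `u` and `v` denote the resulting bounds for the
`n`-th coefficients, the `n`-th term of the Bohr series is at most `(u + v + uv)|z|^{nk}/k`. The sum
over `n` is elementary apart from a dilogarithm (`hasSum_bohrMajorant`).

The second identity and Harnack's inequality bound `Re(A + B)` below on circles (`growthBound_le`).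
Boundary values of `f` are limits along `|z| → 1`, so their moduli are at least `exp(growthBound α 1
/ k)` (`le_boundaryDist`). The radius equation says exactly that `r` times the exponential of the
majorant equals this number (`radiusFun_eq`). The quotient of the two sides increases with `r`,
which gives both the unique root and the inequality.

For sharpness take `W(ζ) = ζ` and `P = 1 + 2(1 - α)ζ/(1 - ζ)`. All coefficient bounds become
equalities with nonnegative coefficients, and the boundary value over `ζ = -1` has the minimal
modulus. Membership in the class requires univalence (`injOn_logMap`): `log z + A - B` is injective
in the coordinate `log z` and its imaginary part is `arg f`; along a level line of that imaginary
part, `log|f|` has derivative `Re Q > 0`. -/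

/-! ### Power series on the disk, and functions with positive real part -/

/-- `F` is the sum of the power series with coefficients `c` in the unit disk. -/
def HasCoeffs (F : ℂ → ℂ) (c : ℕ → ℂ) : Prop :=
  ∀ z ∈ unitDisk, HasSum (fun n => c n * z ^ n) (F z)

theorem mem_unitDisk {z : ℂ} : z ∈ unitDisk ↔ ‖z‖ < 1 := by
  simp [unitDisk]

theorem mem_unitDisk_iff_mem_eball {z : ℂ} : z ∈ unitDisk ↔ z ∈ Metric.eball (0 : ℂ) 1 := by
  rw [unitDisk, ← Metric.eball_ofReal, ENNReal.ofReal_one]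

theorem isOpen_unitDisk : IsOpen unitDisk := Metric.isOpen_ball

theorem unitDisk_mem_nhds {z : ℂ} (hz : z ∈ unitDisk) : unitDisk ∈ nhds z :=
  isOpen_unitDisk.mem_nhds hz

theorem zero_mem_unitDisk : (0 : ℂ) ∈ unitDisk := by simp [mem_unitDisk]

theorem DifferentiableOn.exists_hasCoeffs {F : ℂ → ℂ} (hF : DifferentiableOn ℂ F unitDisk) :
    ∃ c, HasCoeffs F c := by
  refine ⟨fun n => (n.factorial : ℂ)⁻¹ * iteratedDeriv n F 0, fun z hz => ?_⟩
  have := Complex.hasSum_taylorSeries_on_ball hF hz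
  refine this.congr_fun fun n => ?_
  simp [smul_eq_mul]; ring

namespace HasCoeffs

variable {F G : ℂ → ℂ} {c d : ℕ → ℂ}

theorem congr (h : HasCoeffs F c) (hFG : ∀ z ∈ unitDisk, G z = F z) : HasCoeffs G c :=
  fun z hz => hFG z hz ▸ h z hz

theorem summable_norm (h : HasCoeffs F c) {r : ℝ} (h0 : 0 ≤ r) (h1 : r < 1) :
    Summable (fun n => ‖c n‖ * r ^ n) := by
  have hr : (r : ℂ) ∈ unitDisk := by simp [mem_unitDisk, abs_of_nonneg h0, h1]
  have := (h _ hr).summable.norm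
  simpa [abs_of_nonneg h0] using this

theorem hasFPowerSeriesOnBall (h : HasCoeffs F c) :
    HasFPowerSeriesOnBall F (FormalMultilinearSeries.ofScalars ℂ c) 0 1 := by
  refine ⟨?_, one_pos, ?_⟩
  · refine ENNReal.le_of_forall_nnreal_lt fun r hr => ?_
    refine FormalMultilinearSeries.le_radius_of_summable _ ?_
    have hr1 : (r : ℝ) < 1 := by exact_mod_cast hr
    refine (h.summable_norm r.2 hr1).of_nonneg_of_le (fun n => by positivity) fun n => ?_
    simp
  · intro y hy
    have hy' : y ∈ unitDisk := by
      exact mem_unitDisk_iff_mem_eball.2 hy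
    simpa [FormalMultilinearSeries.ofScalars_apply_eq, mul_comm] using h y hy'

theorem differentiableOn (h : HasCoeffs F c) : DifferentiableOn ℂ F unitDisk := by
  have := h.hasFPowerSeriesOnBall.differentiableOn
  refine this.mono fun z hz => ?_
  exact mem_unitDisk_iff_mem_eball.1 hz

theorem unique (h : HasCoeffs F c) (h' : HasCoeffs F d) : c = d := by
  have := h.hasFPowerSeriesOnBall.hasFPowerSeriesAt.eq_formalMultilinearSeries
    h'.hasFPowerSeriesOnBall.hasFPowerSeriesAt
  funext n
  have := congrArg (fun p => FormalMultilinearSeries.coeff p n) this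
  simpa using this

theorem add (h : HasCoeffs F c) (h' : HasCoeffs G d) :
    HasCoeffs (fun z => F z + G z) (fun n => c n + d n) := fun z hz => by
  simpa [add_mul] using (h z hz).add (h' z hz)

theorem const_mul (h : HasCoeffs F c) (a : ℂ) :
    HasCoeffs (fun z => a * F z) (fun n => a * c n) := fun z hz => by
  simpa [mul_assoc] using (h z hz).mul_left a

theorem one : HasCoeffs (fun _ => 1) (fun n => if n = 0 then 1 else 0) := fun z _ => by
  have := hasSum_ite_eq (0 : ℕ) (1 : ℂ)
  refine this.congr_fun fun n => ?_
  by_cases hn : n = 0 <;> simp [hn]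

theorem mul (h : HasCoeffs F c) (h' : HasCoeffs G d) :
    HasCoeffs (fun z => F z * G z)
      (fun n => ∑ p ∈ Finset.HasAntidiagonal.antidiagonal n, c p.1 * d p.2) := fun z hz => by
  have h1 := (h z hz).summable.norm
  have h2 := (h' z hz).summable.norm
  have h3 := summable_norm_sum_mul_antidiagonal_of_summable_norm h1 h2
  have h4 := tsum_mul_tsum_eq_tsum_sum_antidiagonal_of_summable_norm h1 h2
  rw [(h z hz).tsum_eq, (h' z hz).tsum_eq] at h4
  have h5 := h3.of_norm.hasSum
  rw [← h4] at h5
  refine h5.congr_fun fun n => ?_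
  simp only [Finset.sum_mul]
  refine Finset.sum_congr rfl fun p hp => ?_
  rw [← Finset.HasAntidiagonal.mem_antidiagonal.1 hp, pow_add]; ring

theorem apply_zero (h : HasCoeffs F c) : F 0 = c 0 := by
  have h1 := h 0 zero_mem_unitDisk
  have h2 := hasSum_single (f := fun n => c n * (0 : ℂ) ^ n) 0 (fun n hn => by simp [hn])
  simpa using h1.unique h2

theorem mul_deriv (h : HasCoeffs F c) :
    HasCoeffs (fun z => z * deriv F z) (fun n => n * c n) := fun z hz => by
  have h1 := h.hasFPowerSeriesOnBall.fderiv.hasSum (mem_unitDisk_iff_mem_eball.1 hz)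
  have h2 := h1.mapL (ContinuousLinearMap.apply ℂ ℂ z)
  have h3 : HasSum (fun n : ℕ => ((n + 1 : ℕ) : ℂ) * c (n + 1) * z ^ (n + 1))
      (z * deriv F z) := by
    have e1 : z * deriv F z = ContinuousLinearMap.apply ℂ ℂ z (fderiv ℂ F (0 + z)) := by
      simp only [zero_add, ContinuousLinearMap.apply_apply]
      rw [← fderiv_apply_one_eq_deriv, ← smul_eq_mul, ← map_smul, smul_eq_mul, mul_one]
    rw [e1]
    refine h2.congr_fun fun n => ?_
    simp only [ContinuousLinearMap.apply_apply, FormalMultilinearSeries.derivSeries_apply_diag,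
      FormalMultilinearSeries.ofScalars_apply_eq]
    simp [mul_assoc]
  simpa using (hasSum_nat_add_iff' (f := fun n : ℕ => (n : ℂ) * c n * z ^ n) 1).1 (by simpa using h3)

/-- The Fourier coefficients of `F` on the circle of radius `r`. -/
theorem integral_circle (h : HasCoeffs F c) {r : ℝ} (h0 : 0 ≤ r) (h1 : r < 1) (m : ℤ) :
    ∫ t in (0 : ℝ)..2 * Real.pi,
      F (r * Complex.exp (t * Complex.I)) * Complex.exp (m * t * Complex.I) =
    ∑' n : ℕ, if (n : ℤ) + m = 0 then 2 * Real.pi * (c n * r ^ n) else 0 := by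
  have key : ∀ n : ℕ, ∫ t in (0 : ℝ)..2 * Real.pi,
      c n * (r * Complex.exp (t * Complex.I)) ^ n * Complex.exp (m * t * Complex.I) =
      if (n : ℤ) + m = 0 then 2 * Real.pi * (c n * r ^ n) else 0 := by
    intro n
    have e : ∀ t : ℝ, c n * (r * Complex.exp (t * Complex.I)) ^ n * Complex.exp (m * t * Complex.I)
        = (c n * r ^ n) * Complex.exp ((((n : ℤ) + m : ℤ) * Complex.I) * t) := by
      intro t
      rw [mul_pow, ← Complex.exp_nat_mul, ← mul_assoc, mul_assoc _ (Complex.exp _),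
        ← Complex.exp_add]
      congr 2
      push_cast; ring
    simp_rw [e]
    rw [intervalIntegral.integral_const_mul]
    split_ifs with hn
    · simp [hn]; ring
    · have hne : (((n : ℤ) + m : ℤ) * Complex.I : ℂ) ≠ 0 :=
        mul_ne_zero (by exact_mod_cast hn) Complex.I_ne_zero
      rw [integral_exp_mul_complex hne]
      have : Complex.exp ((((n : ℤ) + m : ℤ) * Complex.I) * (2 * Real.pi : ℝ)) = 1 := by
        rw [Complex.exp_eq_one_iff]
        exact ⟨(n : ℤ) + m, by push_cast; ring⟩
      rw [this]; simp
  have hmem : ∀ t : ℝ, (r * Complex.exp (t * Complex.I) : ℂ) ∈ unitDisk := fun t => by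
    rw [mem_unitDisk, norm_mul, Complex.norm_exp_ofReal_mul_I]
    simpa [abs_of_nonneg h0] using h1
  have hs := intervalIntegral.hasSum_integral_of_dominated_convergence
    (a := 0) (b := 2 * Real.pi) (μ := MeasureTheory.volume)
    (F := fun (n : ℕ) (t : ℝ) => c n * (r * Complex.exp (t * Complex.I)) ^ n *
      Complex.exp (m * t * Complex.I))
    (f := fun t => F (r * Complex.exp (t * Complex.I)) * Complex.exp (m * t * Complex.I))
    (fun n _ => ‖c n‖ * r ^ n)
    (fun n => Continuous.aestronglyMeasurable (by fun_prop))
    (fun n => .of_forall fun t _ => by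
      have e : ((m : ℂ) * t * Complex.I) = ((m * t : ℝ) : ℂ) * Complex.I := by push_cast; ring
      rw [e]
      simp only [norm_mul, norm_pow, Complex.norm_exp_ofReal_mul_I]
      simp [abs_of_nonneg h0])
    (.of_forall fun t _ => h.summable_norm h0 h1)
    intervalIntegrable_const
    (.of_forall fun t _ => (h _ (hmem t)).mul_right _)
  simp_rw [key] at hs
  exact hs.tsum_eq.symm

/-- **Carathéodory's inequality** for functions with positive real part. -/
theorem norm_le_two (h : HasCoeffs F c) (hF0 : F 0 = 1) (hre : ∀ z ∈ unitDisk, 0 ≤ (F z).re)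
    {n : ℕ} (hn : n ≠ 0) : ‖c n‖ ≤ 2 := by
  have hbound : ∀ r : ℝ, 0 ≤ r → r < 1 → ‖c n‖ * r ^ n ≤ 2 := by
    intro r h0 h1
    have hmem : ∀ t : ℝ, (r * Complex.exp (t * Complex.I) : ℂ) ∈ unitDisk := fun t => by
      rw [mem_unitDisk, norm_mul, Complex.norm_exp_ofReal_mul_I]
      simpa [abs_of_nonneg h0] using h1
    set u : ℝ → ℂ := fun t => F (r * Complex.exp (t * Complex.I)) with hu
    have hcont : Continuous u :=
      h.differentiableOn.continuousOn.comp_continuous (by fun_prop) hmem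
    have i0 : ∫ t in (0 : ℝ)..2 * Real.pi, u t = 2 * Real.pi := by
      have := h.integral_circle h0 h1 0
      rw [tsum_eq_single 0 (fun j hj => by simp [hj])] at this
      simpa [← h.apply_zero, hF0] using this
    have i1 : ∫ t in (0 : ℝ)..2 * Real.pi, u t * Complex.exp ((-n : ℤ) * t * Complex.I) =
        2 * Real.pi * (c n * r ^ n) := by
      rw [hu, h.integral_circle h0 h1 (-n),
        tsum_eq_single n (fun j hj => if_neg (by omega))]
      simp
    -- `F` has no coefficient of index `-n`. Conjugating this vanishing integral lets `u` be
    -- replaced by `2 Re u ≥ 0` in the formula for `c n`, so the norm of the integral is at most the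
    -- mean value term.
    have i2 : ∫ t in (0 : ℝ)..2 * Real.pi, u t * Complex.exp ((n : ℤ) * t * Complex.I) = 0 := by
      rw [hu, h.integral_circle h0 h1 n]
      simp only [show ∀ j : ℕ, ¬ ((j : ℤ) + n = 0) by omega, if_false, tsum_zero]
    have i3 : ∫ t in (0 : ℝ)..2 * Real.pi,
        starRingEnd ℂ (u t) * Complex.exp ((-n : ℤ) * t * Complex.I) = 0 := by
      have := Complex.conjCLE.toContinuousLinearMap.intervalIntegral_comp_comm
        (μ := MeasureTheory.volume) (a := 0) (b := 2 * Real.pi)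
        (f := fun t : ℝ => u t * Complex.exp ((n : ℤ) * t * Complex.I))
        (Continuous.intervalIntegrable (by fun_prop) _ _)
      rw [i2, map_zero] at this
      rw [← this]
      congr 1
      funext t
      change _ = starRingEnd ℂ _
      rw [map_mul, ← Complex.exp_conj]
      simp
    have i4 : ∫ t in (0 : ℝ)..2 * Real.pi,
        ((2 * (u t).re : ℝ) : ℂ) * Complex.exp ((-n : ℤ) * t * Complex.I) =
        2 * Real.pi * (c n * r ^ n) := by
      rw [← i1, ← add_zero (∫ t in (0 : ℝ)..2 * Real.pi, u t * _), ← i3,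
        ← intervalIntegral.integral_add]
      · congr 1
        funext t
        rw [← add_mul, Complex.add_conj]
      · exact Continuous.intervalIntegrable (by fun_prop) _ _
      · exact Continuous.intervalIntegrable (by fun_prop) _ _
    have i5 : ∫ t in (0 : ℝ)..2 * Real.pi, 2 * (u t).re = 2 * (2 * Real.pi) := by
      rw [intervalIntegral.integral_const_mul]
      have := Complex.reCLM.intervalIntegral_comp_comm (hcont.intervalIntegrable 0 (2 * Real.pi))
        (μ := MeasureTheory.volume)
      rw [i0] at this
      simpa using this
    have i6 : ‖(2 * Real.pi * (c n * r ^ n) : ℂ)‖ ≤ 2 * (2 * Real.pi) := by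
      rw [← i4, ← i5]
      refine (intervalIntegral.norm_integral_le_integral_norm (by positivity)).trans_eq ?_
      refine congrArg (fun v : ℝ → ℝ => ∫ t in (0 : ℝ)..2 * Real.pi, v t) (funext fun t => ?_)
      have e : (((-n : ℤ) : ℂ) * t * Complex.I) = ((-n * t : ℝ) : ℂ) * Complex.I := by
        push_cast; ring
      rw [e, norm_mul, Complex.norm_exp_ofReal_mul_I, mul_one, Complex.norm_real,
        Real.norm_of_nonneg (by have := hre _ (hmem t); positivity)]
    have e : ‖(2 * Real.pi * (c n * r ^ n) : ℂ)‖ = 2 * Real.pi * (‖c n‖ * r ^ n) := by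
      simp [abs_of_nonneg h0, abs_of_pos Real.pi_pos]
    rw [e] at i6
    nlinarith [Real.pi_pos]
  have hlim : Filter.Tendsto (fun r : ℝ => ‖c n‖ * r ^ n) (nhdsWithin 1 (Set.Iio 1))
      (nhds (‖c n‖ * 1 ^ n)) :=
    ((continuous_const.mul (continuous_pow n)).tendsto 1).mono_left nhdsWithin_le_nhds
  have := le_of_tendsto hlim (b := 2) (by
    filter_upwards [Ioo_mem_nhdsLT (show (0 : ℝ) < 1 by norm_num)] with r hr
    exact hbound r hr.1.le hr.2)
  simpa using this

end HasCoeffs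

/-- The Harnack lower bound for functions with positive real part. -/
theorem harnack_re_ge {F : ℂ → ℂ} (hF : DifferentiableOn ℂ F unitDisk) (h0 : F 0 = 1)
    (hre : ∀ z ∈ unitDisk, 0 < (F z).re) {z : ℂ} (hz : z ∈ unitDisk) :
    (1 - ‖z‖) / (1 + ‖z‖) ≤ (F z).re := by
  have hne : ∀ w ∈ unitDisk, F w + 1 ≠ 0 := fun w hw h => by
    have h1 := congrArg Complex.re h
    have h2 := hre w hw
    simp at h1; linarith
  -- The Cayley transform sends the right half-plane into the disk and `F 0 = 1` to `0`, so the
  -- Schwarz lemma applies.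
  have hmaps : Set.MapsTo (fun w => (F w - 1) / (F w + 1)) (Metric.ball 0 1)
      (Metric.closedBall 0 1) := fun w hw => by
    rw [mem_closedBall_zero_iff, norm_div, div_le_one (norm_pos_iff.2 (hne w hw)),
      ← sq_le_sq₀ (norm_nonneg _) (norm_nonneg _), Complex.sq_norm, Complex.sq_norm,
      Complex.normSq_apply, Complex.normSq_apply]
    have := hre w hw
    simp; nlinarith
  have hd : DifferentiableOn ℂ (fun w => (F w - 1) / (F w + 1)) (Metric.ball 0 1) :=
    (hF.sub_const 1).div (hF.add_const 1) hne
  have hs := Complex.norm_le_norm_of_mapsTo_ball hd hmaps (by simp [h0]) (mem_unitDisk.1 hz)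
  have ht : 0 ≤ ‖z‖ := norm_nonneg z
  have ht1 : ‖z‖ < 1 := mem_unitDisk.1 hz
  have hx := hre z hz
  rw [norm_div, div_le_iff₀ (norm_pos_iff.2 (hne z hz)),
    ← sq_le_sq₀ (norm_nonneg _) (by positivity), mul_pow, Complex.sq_norm (F z - 1),
    Complex.sq_norm (F z + 1), Complex.normSq_apply, Complex.normSq_apply] at hs
  simp only [Complex.sub_re, Complex.one_re, Complex.sub_im, Complex.one_im, sub_zero,
    Complex.add_re, Complex.add_im, add_zero] at hs
  rw [div_le_iff₀ (by positivity)]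
  -- The imaginary part enters the squared inequality with the factor `1 - ‖z‖²` on the smaller
  -- side, so it can be dropped.
  have h1 : ((F z).re - 1) ^ 2 ≤ (‖z‖ * ((F z).re + 1)) ^ 2 := by
    nlinarith [mul_nonneg (show 0 ≤ 1 - ‖z‖ ^ 2 by nlinarith) (mul_self_nonneg (F z).im)]
  have h2 := neg_le_of_abs_le (abs_le_of_sq_le_sq h1 (by positivity))
  linarith

/-! ### Pairs of logarithms and their coefficient bounds -/

/-- `A` and `B` are the logarithms of the factors `h` and `g` of the logharmonic mapping
`z ↦ z h(z) conj (g(z))`, which is starlike of order `α` and has second dilatation `W`. -/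
structure IsLogPair (α : ℝ) (A B W : ℂ → ℂ) : Prop where
  diff_A : DifferentiableOn ℂ A unitDisk
  diff_B : DifferentiableOn ℂ B unitDisk
  diff_W : DifferentiableOn ℂ W unitDisk
  A_zero : A 0 = 0
  B_zero : B 0 = 0
  norm_W_lt : ∀ z ∈ unitDisk, ‖W z‖ < 1
  equation : ∀ z ∈ unitDisk, z * deriv B z = W z * (1 + z * deriv A z)
  starlike : ∀ z ∈ unitDisk, α < (1 + z * deriv A z - z * deriv B z).re

theorem one_sub_ne_zero_of_norm_lt {w : ℂ} (h : ‖w‖ < 1) : 1 - w ≠ 0 := by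
  intro h'
  rw [← sub_eq_zero.1 h'] at h
  simp at h

theorem cayley_re_pos {w : ℂ} (h : ‖w‖ < 1) : 0 < ((1 + w) / (1 - w)).re := by
  have h1 := Complex.normSq_pos.2 (one_sub_ne_zero_of_norm_lt h)
  have h2 : w.re * w.re + w.im * w.im < 1 := by
    rw [← Complex.normSq_apply, ← Complex.sq_norm]
    nlinarith [norm_nonneg w]
  rw [Complex.div_re, ← add_div]
  refine div_pos ?_ h1
  simp; nlinarith

namespace IsLogPair

variable {α : ℝ} {A B W : ℂ → ℂ}

theorem W_zero (h : IsLogPair α A B W) : W 0 = 0 := by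
  simpa using (h.equation 0 zero_mem_unitDisk).symm

theorem one_sub_W_ne (h : IsLogPair α A B W) {z : ℂ} (hz : z ∈ unitDisk) : 1 - W z ≠ 0 :=
  one_sub_ne_zero_of_norm_lt (h.norm_W_lt z hz)

theorem deriv_eq (h : IsLogPair α A B W) {z : ℂ} (hz : z ∈ unitDisk) :
    z * deriv B z = ((1 + W z) / (1 - W z) - 1) / 2 * (1 + z * deriv A z - z * deriv B z) := by
  have h1 := h.one_sub_W_ne hz
  rw [h.equation z hz]
  field_simp
  ring

theorem one_add_deriv_eq (h : IsLogPair α A B W) {z : ℂ} (hz : z ∈ unitDisk) :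
    1 + z * (deriv A z + deriv B z) =
      (1 + z * deriv A z - z * deriv B z) * ((1 + W z) / (1 - W z)) := by
  have h1 := h.one_sub_W_ne hz
  rw [mul_add, h.equation z hz]
  field_simp
  ring

theorem diff_starlike (h : IsLogPair α A B W) :
    DifferentiableOn ℂ (fun z => 1 + z * deriv A z - z * deriv B z) unitDisk := by
  have h1 := h.diff_A.deriv isOpen_unitDisk
  have h2 := h.diff_B.deriv isOpen_unitDisk
  fun_prop

theorem diff_cayley (h : IsLogPair α A B W) :
    DifferentiableOn ℂ (fun z => (1 + W z) / (1 - W z)) unitDisk :=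
  (h.diff_W.const_add 1).div (h.diff_W.const_sub 1) fun _ hz => h.one_sub_W_ne hz

/-- Carathéodory's inequality for `(P - α)/(1 - α)`, where `P = 1 + zA' - zB'`. -/
theorem coeff_starlike_le (h : IsLogPair α A B W) (hα : α < 1) {p : ℕ → ℂ}
    (hp : HasCoeffs (fun z => 1 + z * deriv A z - z * deriv B z) p) {n : ℕ} (hn : n ≠ 0) :
    ‖p n‖ ≤ 2 * (1 - α) := by
  have hα' : (1 - α : ℂ) ≠ 0 := by
    intro h'
    have := congrArg Complex.re h'
    simp at this; linarith
  have h1 := (hp.add (HasCoeffs.one.const_mul (-α))).const_mul ((1 - α : ℝ) : ℂ)⁻¹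
  have h2 := h1.norm_le_two (by simp; rw [← sub_eq_add_neg]; exact inv_mul_cancel₀ hα')
    (fun z hz => ?_) hn
  · rw [if_neg hn, mul_zero, add_zero, norm_mul, norm_inv, Complex.norm_real,
      Real.norm_of_nonneg (by linarith), inv_mul_le_iff₀ (by linarith)] at h2
    linarith
  · rw [← Complex.ofReal_inv, Complex.re_ofReal_mul]
    have := h.starlike z hz
    refine mul_nonneg (inv_nonneg.2 (by linarith)) ?_
    simp at this ⊢; linarith

/-- Comparing coefficients in `deriv_eq` gives `n b n = ∑ c j * p (n - j)`, where `c` belongs to `(Q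
- 1)/2` and `p` to `P`. Here `c 0 = 0`, `|c j| ≤ 1`, `p 0 = 1` and otherwise `|p j| ≤ 2(1 - α)`, so
the bound is `(n - 1) * 2(1 - α) + 1`. -/
theorem coeff_B_le (h : IsLogPair α A B W) (hα : α < 1) {b : ℕ → ℂ} (hb : HasCoeffs B b) {n : ℕ}
    (hn : n ≠ 0) : n * ‖b n‖ ≤ 2 * (1 - α) * n + (2 * α - 1) := by
  obtain ⟨p, hp⟩ := h.diff_starlike.exists_hasCoeffs
  obtain ⟨q, hq⟩ := h.diff_cayley.exists_hasCoeffs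
  have hp0 : p 0 = 1 := by simpa using hp.apply_zero.symm
  have hpn : ∀ m ≠ 0, ‖p m‖ ≤ 2 * (1 - α) := fun m hm => h.coeff_starlike_le hα hp hm
  have hqn : ∀ m ≠ 0, ‖q m‖ ≤ 2 := fun m hm => hq.norm_le_two (by simp [h.W_zero])
    (fun z hz => (cayley_re_pos (h.norm_W_lt z hz)).le) hm
  have hc := (hq.add (HasCoeffs.one.const_mul (-1))).const_mul (1 / 2)
  set c : ℕ → ℂ := fun n => 1 / 2 * (q n + -1 * if n = 0 then 1 else 0) with hcdef
  have hc0 : c 0 = 0 := by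
    have := hc.apply_zero
    simpa [h.W_zero] using this.symm
  have hcn : ∀ m ≠ 0, ‖c m‖ ≤ 1 := fun m hm => by
    have := hqn m hm
    simp [hcdef, hm]; linarith
  have key := hb.mul_deriv.unique ((hc.mul hp).congr fun z hz => by
    linear_combination h.deriv_eq hz)
  have hn' := congrFun key n
  obtain ⟨m, rfl⟩ := Nat.exists_eq_succ_of_ne_zero hn
  have e : ((m + 1 : ℕ) : ℝ) * ‖b (m + 1)‖ = ‖((m + 1 : ℕ) : ℂ) * b (m + 1)‖ := by
    rw [norm_mul, Complex.norm_natCast]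
  -- Both end terms are split off: the first vanishes by `c 0 = 0`, and the last carries `p 0 = 1`.
  rw [Nat.succ_eq_add_one, e, hn', Finset.Nat.sum_antidiagonal_eq_sum_range_succ_mk,
    Finset.sum_range_succ, Finset.sum_range_succ']
  simp only [hc0, zero_mul, add_zero, Nat.sub_self, hp0, mul_one]
  have hsum : ‖∑ i ∈ Finset.range m, c (i + 1) * p (m - i)‖ ≤ m * (2 * (1 - α)) := by
    refine (norm_sum_le_of_le (Finset.range m) (f := fun i => c (i + 1) * p (m - i))
      (n := fun _ => 2 * (1 - α)) fun i hi => ?_).trans_eq (by simp)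
    have := Finset.mem_range.1 hi
    rw [norm_mul, ← one_mul (2 * (1 - α))]
    exact mul_le_mul (hcn _ (by omega)) (hpn _ (by omega)) (norm_nonneg _) zero_le_one
  have := hcn (m + 1) (by omega)
  refine (norm_add_le _ _).trans ?_
  push_cast
  linarith

/-- `n a n` is `n b n` plus the `n`-th coefficient of `P`, and both are already bounded. -/
theorem coeff_A_le (h : IsLogPair α A B W) (hα : α < 1) {a : ℕ → ℂ} (ha : HasCoeffs A a) {n : ℕ}
    (hn : n ≠ 0) : n * ‖a n‖ ≤ 2 * (1 - α) * n + 1 := by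
  obtain ⟨b, hb⟩ := h.diff_B.exists_hasCoeffs
  have hp := (HasCoeffs.one.add ha.mul_deriv).add (hb.mul_deriv.const_mul (-1))
  have h1 := h.coeff_starlike_le hα (hp.congr fun z _ => by ring) hn
  have h2 := h.coeff_B_le hα hb hn
  have e : (n : ℂ) * a n = ((if n = 0 then 1 else 0) + n * a n + -1 * (n * b n)) + n * b n := by
    rw [if_neg hn]; ring
  have e' : ∀ c : ℂ, n * ‖c‖ = ‖(n : ℂ) * c‖ := fun c => by rw [norm_mul, Complex.norm_natCast]
  rw [e'] at h2 ⊢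
  rw [e]
  exact (norm_add_le _ _).trans (by linarith)

end IsLogPair

/-! ### Growth theorem -/

/-- The sharp lower bound of `Re (A + B)` on the circle of radius `t`. -/
def growthBound (α t : ℝ) : ℝ := -2 * α * Real.log (1 + t) - 4 * (1 - α) * (t / (1 + t))

theorem hasDerivAt_growthBound (α : ℝ) {t : ℝ} (ht : 0 ≤ t) :
    HasDerivAt (growthBound α) (-2 * α / (1 + t) - 4 * (1 - α) / (1 + t) ^ 2) t := by
  have h0 : 1 + t ≠ 0 := by positivity
  have h1 : HasDerivAt (fun t : ℝ => 1 + t) 1 t := (hasDerivAt_id t).const_add 1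
  have h2 := ((h1.log h0).const_mul (-2 * α)).sub
    (((hasDerivAt_id t).div h1 h0).const_mul (4 * (1 - α)))
  refine h2.congr_deriv ?_
  simp
  field_simp

/-- One-sided on purpose: the minimum in `growthBound_le` may lie on the edge of the ball, where
only inward moves are allowed. -/
theorem HasDerivAt.nonpos_of_le_of_neg {φ : ℝ → ℝ} {d : ℝ} (h : HasDerivAt φ d 0)
    (hle : ∀ x < 0, φ 0 ≤ φ x) : d ≤ 0 := by
  have h1 := (hasDerivAt_iff_tendsto_slope.1 h).mono_left
    (nhdsLT_le_nhdsNE (0 : ℝ))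
  refine le_of_tendsto h1 ?_
  filter_upwards [self_mem_nhdsWithin] with x hx
  rw [slope_def_field, sub_zero]
  exact div_nonpos_of_nonneg_of_nonpos (sub_nonneg.2 (hle x hx)) (le_of_lt hx)

namespace IsLogPair

variable {α : ℝ} {A B W : ℂ → ℂ}

/-- The left side is `t` times the derivative of `growthBound α` at `t = ‖z‖`. In general `Re(PQ) =
Re P Re Q - Im P Im Q` is not controlled by the real parts. When `PQ` is real, however, `Im P Im Q ≤
0`, and Harnack's bounds for `Re P` and `Re Q` may be multiplied. -/
theorem re_mul_ge (h : IsLogPair α A B W) (hα : α < 1) (hα₀ : 0 ≤ α) {z : ℂ} (hz : z ∈ unitDisk)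
    (him : (z * (deriv A z + deriv B z)).im = 0) :
    ‖z‖ * (-2 * α / (1 + ‖z‖) - 4 * (1 - α) / (1 + ‖z‖) ^ 2) ≤
      (z * (deriv A z + deriv B z)).re := by
  have ht1 := mem_unitDisk.1 hz
  have ht0 := norm_nonneg z
  have key := h.one_add_deriv_eq hz
  have hQ := harnack_re_ge h.diff_cayley (by simp [h.W_zero])
    (fun z hz => cayley_re_pos (h.norm_W_lt z hz)) hz
  have hαc : (1 - α : ℂ) ≠ 0 := by exact_mod_cast (show (1 - α : ℝ) ≠ 0 by linarith)
  have hα' : 0 < 1 - α := by linarith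
  have hP := harnack_re_ge (F := fun z => ((1 - α : ℝ) : ℂ)⁻¹ *
      (1 + z * deriv A z - z * deriv B z - α)) ((h.diff_starlike.sub_const _).const_mul _)
    (by simpa using inv_mul_cancel₀ hαc) (fun z hz => by
      rw [← Complex.ofReal_inv, Complex.re_ofReal_mul]
      have := h.starlike z hz
      refine mul_pos (inv_pos.2 hα') ?_
      simp at this ⊢; linarith) hz
  have hPpos := h.starlike z hz
  rw [← Complex.ofReal_inv, Complex.re_ofReal_mul, inv_mul_eq_div, le_div_iff₀ hα',
    Complex.sub_re, Complex.ofReal_re] at hP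
  set P := 1 + z * deriv A z - z * deriv B z
  set Q := (1 + W z) / (1 - W z)
  have hQpos : 0 < Q.re := cayley_re_pos (h.norm_W_lt z hz)
  have him' : P.re * Q.im + P.im * Q.re = 0 := by
    rw [← Complex.mul_im, ← key]; simpa using him
  have hre : (z * (deriv A z + deriv B z)).re = P.re * Q.re - P.im * Q.im - 1 := by
    rw [← Complex.mul_re, ← key]; simp
  rw [hre]
  have h1 : P.im * Q.im ≤ 0 := by
    have : P.im * Q.im * Q.re = -(P.re * Q.im ^ 2) := by linear_combination Q.im * him'
    have h2 : 0 ≤ P.re * Q.im ^ 2 := mul_nonneg (by linarith) (sq_nonneg _)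
    by_contra h3
    push Not at h3
    nlinarith [mul_pos h3 hQpos]
  set t := ‖z‖
  have h2 : (1 + (2 * α - 1) * t) / (1 + t) ≤ P.re := by
    refine le_trans (le_of_eq ?_) (show (1 - t) / (1 + t) * (1 - α) + α ≤ P.re by linarith)
    field_simp; ring
  have h3 : (1 + (2 * α - 1) * t) / (1 + t) * ((1 - t) / (1 + t)) ≤ P.re * Q.re :=
    mul_le_mul h2 hQ (div_nonneg (by linarith) (by linarith)) (by linarith)
  have h4 : t * (-2 * α / (1 + t) - 4 * (1 - α) / (1 + t) ^ 2) =
      (1 + (2 * α - 1) * t) / (1 + t) * ((1 - t) / (1 + t)) - 1 := by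
    field_simp; ring
  linarith

/-- Used with `s = I` for the angular derivative and `s = 1` for the radial one. -/
theorem hasDerivAt_re_comp (h : IsLogPair α A B W) {z : ℂ} (hz : z ∈ unitDisk) (s : ℂ) :
    HasDerivAt (fun x : ℝ => (A (Complex.exp (x * s) * z) + B (Complex.exp (x * s) * z)).re)
      (s * (z * (deriv A z + deriv B z))).re 0 := by
  have h1 : HasDerivAt (fun x : ℂ => Complex.exp (x * s) * z) (s * z) ((0 : ℝ) : ℂ) := by
    have := (((hasDerivAt_id (((0 : ℝ) : ℂ))).mul_const s).cexp).mul_const z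
    simpa using this
  have h2 : HasDerivAt (fun w => A w + B w) (deriv A z + deriv B z)
      (Complex.exp (((0 : ℝ) : ℂ) * s) * z) := by
    rw [Complex.ofReal_zero, zero_mul, Complex.exp_zero, one_mul]
    exact (h.diff_A.differentiableAt (unitDisk_mem_nhds hz)).hasDerivAt.add
      (h.diff_B.differentiableAt (unitDisk_mem_nhds hz)).hasDerivAt
  have h3 := (h2.comp ((0 : ℝ) : ℂ) h1).real_of_complex
  refine h3.congr_deriv ?_
  congr 1
  ring

/-- The growth theorem for starlike logharmonic mappings. -/
theorem growthBound_le (h : IsLogPair α A B W) (hα : α < 1) (hα₀ : 0 ≤ α) {z : ℂ}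
    (hz : z ∈ unitDisk) : growthBound α ‖z‖ ≤ (A z + B z).re := by
  have main : ∀ ε > 0, growthBound α ‖z‖ - ε * ‖z‖ ≤ (A z + B z).re := by
    intro ε hε
    -- The term `ε‖w‖` makes the radial derivative strictly positive at any critical angle, so a
    -- minimum of `v` can only sit at the origin, where `v = 0`.
    set v : ℂ → ℝ := fun w => (A w + B w).re - growthBound α ‖w‖ + ε * ‖w‖ with hv
    have hsub : Metric.closedBall (0 : ℂ) ‖z‖ ⊆ unitDisk := fun w hw => by
      rw [mem_unitDisk]; rw [mem_closedBall_zero_iff] at hw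
      exact hw.trans_lt (mem_unitDisk.1 hz)
    have hcont : ContinuousOn v (Metric.closedBall 0 ‖z‖) := by
      have h1 := h.diff_A.continuousOn.mono hsub
      have h2 := h.diff_B.continuousOn.mono hsub
      have h3 : ContinuousOn (fun w : ℂ => growthBound α ‖w‖) (Metric.closedBall 0 ‖z‖) :=
        fun w _ => ((hasDerivAt_growthBound α (norm_nonneg w)).continuousAt.comp
          continuous_norm.continuousAt).continuousWithinAt
      exact ((Complex.continuous_re.comp_continuousOn (h1.add h2)).sub h3).add (by fun_prop)
    obtain ⟨w, hw, hmin⟩ := (isCompact_closedBall (0 : ℂ) ‖z‖).exists_isMinOn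
      ⟨0, by simp⟩ hcont
    have hw0 : w = 0 := by
      by_contra hne
      have hwD := hsub hw
      have hwpos : 0 < ‖w‖ := norm_pos_iff.2 hne
      have hrot : ∀ x : ℝ, ‖Complex.exp (x * Complex.I) * w‖ = ‖w‖ := fun x => by
        rw [norm_mul, Complex.norm_exp_ofReal_mul_I, one_mul]
      have hrad : ∀ x : ℝ, ‖Complex.exp (x * 1) * w‖ = Real.exp x * ‖w‖ := fun x => by
        rw [norm_mul, mul_one, Complex.norm_exp, Complex.ofReal_re]
      -- All the radial terms of `v` are constant under rotation, so minimality in the angle makes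
      -- `PQ` real at `w`; this is the case `re_mul_ge` covers.
      have him : (w * (deriv A w + deriv B w)).im = 0 := by
        rw [← neg_eq_zero, ← Complex.I_mul_re]
        have h1 := h.hasDerivAt_re_comp hwD Complex.I
        have h2 : IsLocalMin (fun x : ℝ => (A (Complex.exp (x * Complex.I) * w) +
            B (Complex.exp (x * Complex.I) * w)).re) 0 := by
          refine Filter.Eventually.of_forall fun x => ?_
          have h3 := hmin (a := Complex.exp (x * Complex.I) * w)
            (by rw [mem_closedBall_zero_iff, hrot]; exact mem_closedBall_zero_iff.1 hw)
          simp only [hv, hrot, Set.mem_ofPred_eq] at h3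
          simp only [Complex.ofReal_zero, zero_mul, Complex.exp_zero, one_mul]
          linarith
        exact h2.hasDerivAt_eq_zero h1
      have hge := h.re_mul_ge hα hα₀ hwD him
      have h1 := h.hasDerivAt_re_comp hwD 1
      have hexp : HasDerivAt (fun x : ℝ => Real.exp x * ‖w‖) ‖w‖ 0 := by
        simpa using (Real.hasDerivAt_exp 0).mul_const ‖w‖
      have h2 := (hasDerivAt_growthBound α (norm_nonneg w))
      have h2' : HasDerivAt (growthBound α) (-2 * α / (1 + ‖w‖) - 4 * (1 - α) / (1 + ‖w‖) ^ 2)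
          (Real.exp 0 * ‖w‖) := by simpa using h2
      have h3 := (h1.sub (h2'.comp 0 hexp)).add (hexp.const_mul ε)
      have h4 := h3.nonpos_of_le_of_neg (fun x hx => by
        have h5 := hmin (a := Complex.exp (x * 1) * w) (by
          rw [mem_closedBall_zero_iff, hrad]
          refine le_trans ?_ (mem_closedBall_zero_iff.1 hw)
          have : Real.exp x ≤ 1 := Real.exp_le_one_iff.2 hx.le
          nlinarith)
        simp only [hv, hrad, Set.mem_ofPred_eq] at h5
        simpa using h5)
      have h6 : 0 < ε * ‖w‖ := by positivity
      rw [one_mul] at h4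
      linarith
    have h1 := hmin (a := z) (by simp)
    simp only [hv, hw0, Set.mem_ofPred_eq, norm_zero, h.A_zero, h.B_zero] at h1
    simp [growthBound] at h1 ⊢
    linarith
  refine le_of_tendsto (f := fun ε : ℝ => growthBound α ‖z‖ - ε * ‖z‖)
    (x := nhdsWithin 0 (Set.Ioi 0)) ?_ (by
      filter_upwards [self_mem_nhdsWithin] with ε hε using main ε hε)
  have : Continuous fun ε : ℝ => growthBound α ‖z‖ - ε * ‖z‖ := by fun_prop
  simpa using (this.tendsto 0).mono_left nhdsWithin_le_nhds

end IsLogPair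

/-! ### Wirtinger calculus for the `k`-fold symmetric mapping -/

/-- The real-linear map `v ↦ p v + q conj(v)`. -/
def wirtingerCLM (p q : ℂ) : ℂ →L[ℝ] ℂ :=
  p • ContinuousLinearMap.id ℝ ℂ + q • Complex.conjCLE.toContinuousLinearMap

theorem wirtingerCLM_apply (p q v : ℂ) : wirtingerCLM p q v = p * v + q * starRingEnd ℂ v := by
  simp [wirtingerCLM]

theorem HasFDerivAt.dz_eq {f : ℂ → ℂ} {p q z : ℂ} (h : HasFDerivAt f (wirtingerCLM p q) z) :
    dz f z = p := by
  rw [dz, h.fderiv, wirtingerCLM_apply, wirtingerCLM_apply]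
  simp only [map_one, mul_one, Complex.conj_I]
  linear_combination (-p / 2 + q / 2) * Complex.I_sq

theorem HasFDerivAt.dzbar_eq {f : ℂ → ℂ} {p q z : ℂ} (h : HasFDerivAt f (wirtingerCLM p q) z) :
    dzbar f z = q := by
  rw [dzbar, h.fderiv, wirtingerCLM_apply, wirtingerCLM_apply]
  simp only [map_one, mul_one, Complex.conj_I]
  linear_combination (p / 2 - q / 2) * Complex.I_sq

theorem HasStrictDerivAt.mul_conj {u v : ℂ → ℂ} {u' v' z : ℂ} (hu : HasStrictDerivAt u u' z)
    (hv : HasStrictDerivAt v v' z) :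
    HasStrictFDerivAt (fun w => u w * starRingEnd ℂ (v w))
      (wirtingerCLM (u' * starRingEnd ℂ (v z)) (u z * starRingEnd ℂ v')) z := by
  have h1 := hu.hasStrictFDerivAt.restrictScalars ℝ
  have h2 := Complex.conjCLE.toContinuousLinearMap.hasStrictFDerivAt.comp z
    (hv.hasStrictFDerivAt.restrictScalars ℝ)
  refine (h1.mul h2).congr_fderiv ?_
  ext w
  all_goals simp [wirtingerCLM_apply]; ring

/-- The strict inequality makes the kernel trivial, and in finite dimension injective means
surjective. -/
theorem wirtingerCLM_range_eq_top {p q : ℂ} (h : ‖q‖ < ‖p‖) : (wirtingerCLM p q).range = ⊤ := by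
  rw [LinearMap.range_eq_top]
  refine LinearMap.injective_iff_surjective.1 ((injective_iff_map_eq_zero _).2 fun v hv => ?_)
  have h1 : p * v = -(q * starRingEnd ℂ v) := by
    rw [← add_eq_zero_iff_eq_neg, ← wirtingerCLM_apply]; exact hv
  have h2 := congrArg norm h1
  rw [norm_neg, norm_mul, norm_mul, Complex.norm_conj] at h2
  by_contra hne
  exact absurd h2 (mul_lt_mul_of_pos_right h (norm_pos_iff.2 hne)).ne'

theorem pow_mem_unitDisk {k : ℕ} (hk : 1 ≤ k) {z : ℂ} (hz : z ∈ unitDisk) : z ^ k ∈ unitDisk := by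
  rw [mem_unitDisk, norm_pow]
  exact pow_lt_one₀ (norm_nonneg z) (mem_unitDisk.1 hz) (by omega)

/-- The `k`-fold symmetric mapping `z exp (A(z^k)/k) conj (exp (B(z^k)/k))`. -/
def logMap (k : ℕ) (A B : ℂ → ℂ) (z : ℂ) : ℂ :=
  z * Complex.exp (A (z ^ k) / k) * starRingEnd ℂ (Complex.exp (B (z ^ k) / k))

theorem logMap_eq_zero_iff {k : ℕ} {A B : ℂ → ℂ} {z : ℂ} : logMap k A B z = 0 ↔ z = 0 := by
  simp [logMap]

theorem norm_logMap (k : ℕ) (A B : ℂ → ℂ) (z : ℂ) :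
    ‖logMap k A B z‖ = ‖z‖ * Real.exp ((A (z ^ k) + B (z ^ k)).re / k) := by
  rw [logMap, norm_mul, norm_mul, Complex.norm_conj, Complex.norm_exp, Complex.norm_exp, mul_assoc,
    ← Real.exp_add, ← Complex.add_re, ← add_div, Complex.div_natCast_re]

theorem HasStrictDerivAt.cexp_comp_pow {k : ℕ} (hk : 1 ≤ k) {A : ℂ → ℂ} {A' z : ℂ}
    (hA : HasStrictDerivAt A A' (z ^ k)) :
    HasStrictDerivAt (fun w => Complex.exp (A (w ^ k) / k))
      (Complex.exp (A (z ^ k) / k) * (A' * z ^ (k - 1))) z := by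
  have hk' : (k : ℂ) ≠ 0 := by exact_mod_cast (by omega : k ≠ 0)
  have h0 : HasStrictDerivAt (fun w : ℂ => w ^ k) (k * z ^ (k - 1)) z := hasStrictDerivAt_pow k z
  have h1 := ((hA.comp (h := fun w : ℂ => w ^ k) z h0).div_const (k : ℂ)).cexp
  refine h1.congr_deriv ?_
  simp only [Function.comp]
  field_simp

theorem hasStrictFDerivAt_logMap {k : ℕ} (hk : 1 ≤ k) {A B : ℂ → ℂ}
    (hA : DifferentiableOn ℂ A unitDisk) (hB : DifferentiableOn ℂ B unitDisk) {z : ℂ}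
    (hz : z ∈ unitDisk) :
    HasStrictFDerivAt (logMap k A B)
      (wirtingerCLM
        (Complex.exp (A (z ^ k) / k) * (1 + z ^ k * deriv A (z ^ k)) *
          starRingEnd ℂ (Complex.exp (B (z ^ k) / k)))
        (z * Complex.exp (A (z ^ k) / k) *
          starRingEnd ℂ (Complex.exp (B (z ^ k) / k) * (deriv B (z ^ k) * z ^ (k - 1))))) z := by
  have hzk := unitDisk_mem_nhds (pow_mem_unitDisk hk hz)
  have hA' := (hA.analyticAt hzk).hasStrictDerivAt.cexp_comp_pow hk
  have hB' := (hB.analyticAt hzk).hasStrictDerivAt.cexp_comp_pow hk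
  refine (((hasStrictDerivAt_id z).mul hA').mul_conj hB').congr_fderiv ?_
  congr 2
  have e : z ^ k = z * z ^ (k - 1) := by rw [← pow_succ', Nat.sub_add_cancel hk]
  simp only [id]
  linear_combination (-Complex.exp (A (z ^ k) / k) * deriv A (z ^ k)) * e

theorem dz_logMap {k : ℕ} (hk : 1 ≤ k) {A B : ℂ → ℂ} (hA : DifferentiableOn ℂ A unitDisk)
    (hB : DifferentiableOn ℂ B unitDisk) {z : ℂ} (hz : z ∈ unitDisk) :
    z * dz (logMap k A B) z = (1 + z ^ k * deriv A (z ^ k)) * logMap k A B z := by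
  rw [(hasStrictFDerivAt_logMap hk hA hB hz).hasFDerivAt.dz_eq, logMap]
  ring

theorem dzbar_logMap {k : ℕ} (hk : 1 ≤ k) {A B : ℂ → ℂ} (hA : DifferentiableOn ℂ A unitDisk)
    (hB : DifferentiableOn ℂ B unitDisk) {z : ℂ} (hz : z ∈ unitDisk) :
    starRingEnd ℂ z * dzbar (logMap k A B) z =
      starRingEnd ℂ (z ^ k * deriv B (z ^ k)) * logMap k A B z := by
  have e : z ^ k = z * z ^ (k - 1) := by rw [← pow_succ', Nat.sub_add_cancel hk]
  have e' : starRingEnd ℂ (z ^ k * deriv B (z ^ k)) =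
      starRingEnd ℂ z * starRingEnd ℂ (deriv B (z ^ k) * z ^ (k - 1)) := by
    rw [← map_mul]; congr 1; linear_combination deriv B (z ^ k) * e
  rw [(hasStrictFDerivAt_logMap hk hA hB hz).hasFDerivAt.dzbar_eq, logMap, e', map_mul]
  ring

/-! ### Open image and distance to its boundary -/

namespace IsLogPair

variable {k : ℕ} {α : ℝ} {A B W : ℂ → ℂ}

theorem one_add_ne (h : IsLogPair α A B W) (hα₀ : 0 ≤ α) {z : ℂ} (hz : z ∈ unitDisk) :
    1 + z * deriv A z ≠ 0 := fun h0 => by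
  have h1 := h.starlike z hz
  rw [h.equation z hz, h0] at h1
  simp at h1; linarith

/-- `|W| < 1` and `1 + zA' ≠ 0` give `|f_z̄| < |f_z|`, so the real derivative is onto. This also
covers `z = 0`. -/
theorem map_nhds_logMap (h : IsLogPair α A B W) (hk : 1 ≤ k) (hα₀ : 0 ≤ α) {z : ℂ}
    (hz : z ∈ unitDisk) : Filter.map (logMap k A B) (nhds z) = nhds (logMap k A B z) := by
  refine (hasStrictFDerivAt_logMap hk h.diff_A h.diff_B hz).map_nhds_eq_of_surj
    (wirtingerCLM_range_eq_top ?_)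
  have hzk := pow_mem_unitDisk hk hz
  have hne := h.one_add_ne hα₀ hzk
  have e : z ^ k = z * z ^ (k - 1) := by rw [← pow_succ', Nat.sub_add_cancel hk]
  have h1 : ‖z * (deriv B (z ^ k) * z ^ (k - 1))‖ < ‖1 + z ^ k * deriv A (z ^ k)‖ := by
    have : z * (deriv B (z ^ k) * z ^ (k - 1)) = W (z ^ k) * (1 + z ^ k * deriv A (z ^ k)) := by
      rw [← h.equation _ hzk]
      linear_combination (-deriv B (z ^ k)) * e
    rw [this, norm_mul]
    exact mul_lt_of_lt_one_left (norm_pos_iff.2 hne) (h.norm_W_lt _ hzk)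
  simp only [norm_mul, Complex.norm_conj] at h1 ⊢
  have p1 := norm_pos_iff.2 (Complex.exp_ne_zero (A (z ^ k) / k))
  have p2 := norm_pos_iff.2 (Complex.exp_ne_zero (B (z ^ k) / k))
  have := mul_lt_mul_of_pos_right h1 (mul_pos p1 p2)
  linarith

theorem isOpen_image (h : IsLogPair α A B W) (hk : 1 ≤ k) (hα₀ : 0 ≤ α) {V : Set ℂ}
    (hV : IsOpen V) (hVD : V ⊆ unitDisk) : IsOpen (logMap k A B '' V) := by
  rw [isOpen_iff_mem_nhds]
  rintro _ ⟨z, hz, rfl⟩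
  rw [← h.map_nhds_logMap hk hα₀ (hVD hz)]
  exact Filter.image_mem_map (hV.mem_nhds hz)

theorem continuousOn_logMap (h : IsLogPair α A B W) (hk : 1 ≤ k) :
    ContinuousOn (logMap k A B) unitDisk := fun _ hz =>
  (hasStrictFDerivAt_logMap hk h.diff_A h.diff_B hz).continuousAt.continuousWithinAt

/-- A mapping of the class that is injective stays away from each of its values near the unit
circle. -/
theorem exists_norm_lt_of_near_value (h : IsLogPair α A B W) (hk : 1 ≤ k) (hα₀ : 0 ≤ α)
    (hinj : Set.InjOn (logMap k A B) unitDisk) {z₀ : ℂ} (hz₀ : z₀ ∈ unitDisk) :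
    ∃ R < 1, ∃ U ∈ nhds (logMap k A B z₀), ∀ z ∈ unitDisk, logMap k A B z ∈ U → ‖z‖ < R := by
  obtain ⟨R, h1, h2⟩ := exists_between (mem_unitDisk.1 hz₀)
  have hsub : Metric.ball (0 : ℂ) R ⊆ unitDisk := Metric.ball_subset_ball h2.le
  refine ⟨R, h2, logMap k A B '' Metric.ball 0 R,
    (h.isOpen_image hk hα₀ Metric.isOpen_ball hsub).mem_nhds ⟨z₀, by simpa using h1, rfl⟩, ?_⟩
  rintro z hz ⟨w, hw, hwz⟩
  rw [← hinj (hsub hw) hz hwz]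
  simpa using hw

/-- A boundary point is a limit of values `f(z_n)`. A subsequence of `z_n` converges, and its limit
cannot lie inside the disk because the open image misses its frontier. So `|z_n| → 1` along it, and
the growth bound passes to the limit. -/
theorem norm_ge_of_mem_frontier (h : IsLogPair α A B W) (hk : 1 ≤ k) (hα₀ : 0 ≤ α) (hα : α < 1)
    {w : ℂ} (hw : w ∈ frontier (logMap k A B '' unitDisk)) :
    Real.exp (growthBound α 1 / k) ≤ ‖w‖ := by
  rw [(h.isOpen_image hk hα₀ isOpen_unitDisk le_rfl).frontier_eq] at hw
  obtain ⟨u, hu, hlim⟩ := mem_closure_iff_seq_limit.1 hw.1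
  choose z hz hzu using hu
  obtain ⟨x, -, φ, hφ, hx⟩ := (isCompact_closedBall (0 : ℂ) 1).tendsto_subseq
    (x := z) (fun n => by simpa using (mem_unitDisk.1 (hz n)).le)
  have hlim' : Filter.Tendsto (fun n => logMap k A B (z (φ n))) Filter.atTop (nhds w) := by
    simpa [Function.comp_def, hzu] using hlim.comp hφ.tendsto_atTop
  have hx1 : ‖x‖ = 1 := by
    refine le_antisymm (le_of_tendsto hx.norm (.of_forall fun n => (mem_unitDisk.1 (hz _)).le)) ?_
    by_contra hlt
    have hxD : x ∈ unitDisk := mem_unitDisk.2 (not_le.1 hlt)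
    have h2 := ((h.continuousOn_logMap hk).continuousAt (unitDisk_mem_nhds hxD)).tendsto.comp hx
    exact hw.2 ⟨x, hxD, tendsto_nhds_unique h2 hlim'⟩
  have hnorm : Filter.Tendsto (fun n => ‖z (φ n)‖) Filter.atTop (nhds 1) := hx1 ▸ hx.norm
  have h3 : ∀ n, ‖z (φ n)‖ * Real.exp (growthBound α (‖z (φ n)‖ ^ k) / k) ≤
      ‖logMap k A B (z (φ n))‖ := fun n => by
    rw [norm_logMap, ← norm_pow]
    have := h.growthBound_le hα hα₀ (pow_mem_unitDisk hk (hz (φ n)))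
    gcongr
  have h4 : Filter.Tendsto (fun n => ‖z (φ n)‖ * Real.exp (growthBound α (‖z (φ n)‖ ^ k) / k))
      Filter.atTop (nhds (1 * Real.exp (growthBound α 1 / k))) := by
    have h5 : Filter.Tendsto (fun n => ‖z (φ n)‖ ^ k) Filter.atTop (nhds 1) := by
      simpa using hnorm.pow k
    have h6 := (hasDerivAt_growthBound α zero_le_one).continuousAt.tendsto.comp h5
    exact hnorm.mul ((Real.continuous_exp.tendsto _).comp (h6.div_const _))
  have := le_of_tendsto_of_tendsto' h4 hlim'.norm h3
  simpa using this

/-- If the map were onto, injectivity and compactness would force `|f|` to be large near the circle.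
Then the zero-free analytic `G`, with `|G||f| = |z|`, would be at most `1/2` on a circle although `G
0 = 1`, against the maximum principle. -/
theorem image_ne_univ (h : IsLogPair α A B W) (hk : 1 ≤ k) (hα₀ : 0 ≤ α)
    (hinj : Set.InjOn (logMap k A B) unitDisk) : logMap k A B '' unitDisk ≠ Set.univ := by
  intro huniv
  have hproper : ∀ M : ℝ, ∃ R < 1, ∀ z ∈ unitDisk, ‖logMap k A B z‖ ≤ M → ‖z‖ < R := by
    intro M
    have : Nonempty {R : ℝ // R < 1} := ⟨⟨0, zero_lt_one⟩⟩
    obtain ⟨⟨R, hR⟩, hsub⟩ := (isCompact_closedBall (0 : ℂ) M).elim_directed_cover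
      (fun R : {R : ℝ // R < 1} => logMap k A B '' Metric.ball 0 R)
      (fun R => h.isOpen_image hk hα₀ Metric.isOpen_ball (Metric.ball_subset_ball R.2.le))
      (fun w _ => by
        obtain ⟨z, hz, rfl⟩ := huniv.ge (Set.mem_univ w)
        obtain ⟨R, h1, h2⟩ := exists_between (mem_unitDisk.1 hz)
        exact Set.mem_iUnion.2 ⟨⟨R, h2⟩, z, by simpa using h1, rfl⟩)
      (directed_of_isDirected_le fun R R' hle => Set.image_mono (Metric.ball_subset_ball hle))
    refine ⟨R, hR, fun z hz hM => ?_⟩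
    obtain ⟨w, hw, hwz⟩ := hsub (mem_closedBall_zero_iff.2 hM)
    rw [← hinj (Metric.ball_subset_ball hR.le hw) hz hwz]
    simpa using hw
  obtain ⟨R, hR, hRM⟩ := hproper 2
  obtain ⟨r, hr, hr1⟩ := exists_between (max_lt hR zero_lt_one)
  have hr0 : 0 < r := (le_max_right _ _).trans_lt hr
  set G : ℂ → ℂ := fun z => Complex.exp (-(A (z ^ k) + B (z ^ k)) / k)
  have hG : DifferentiableOn ℂ G unitDisk := by
    have hm : Set.MapsTo (fun z : ℂ => z ^ k) unitDisk unitDisk :=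
      fun z hz => pow_mem_unitDisk hk hz
    have h1 := h.diff_A.comp (by fun_prop) hm
    have h2 := h.diff_B.comp (by fun_prop) hm
    exact ((h1.add h2).neg.div_const (k : ℂ)).cexp
  have hGn : ∀ z, ‖G z‖ * ‖logMap k A B z‖ = ‖z‖ := fun z => by
    rw [norm_logMap, Complex.norm_exp, Complex.div_natCast_re, Complex.neg_re, mul_left_comm,
      ← Real.exp_add, neg_div, neg_add_cancel, Real.exp_zero, mul_one]
  have hsub : Metric.closedBall (0 : ℂ) r ⊆ unitDisk := Metric.closedBall_subset_ball hr1
  have hmax := Complex.norm_le_of_forall_mem_frontier_norm_le (U := Metric.ball (0 : ℂ) r) (f := G)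
    (C := 1 / 2) Metric.isBounded_ball
    (hG.diffContOnCl_ball hsub)
    (fun z hz => by
      rw [frontier_ball (0 : ℂ) hr0.ne', mem_sphere_zero_iff_norm] at hz
      have hzD : z ∈ unitDisk := mem_unitDisk.2 (hz ▸ hr1)
      have h1 : 2 < ‖logMap k A B z‖ := by
        by_contra h2
        have := hRM z hzD (not_lt.1 h2)
        exact absurd ((le_max_left R 0).trans_lt hr) (by rw [← hz]; exact not_lt.2 this.le)
      have h3 := hGn z
      have h4 : ‖z‖ < 1 := mem_unitDisk.1 hzD
      nlinarith [norm_nonneg (G z)])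
    (z := 0) (subset_closure (by simpa using hr0))
  have h0 : k ≠ 0 := by omega
  simp only [G, zero_pow h0, h.A_zero, h.B_zero] at hmax
  norm_num at hmax

/-- A lower bound for the distance from the origin to the boundary of the image. -/
theorem le_boundaryDist (h : IsLogPair α A B W) (hk : 1 ≤ k) (hα₀ : 0 ≤ α) (hα : α < 1)
    (hinj : Set.InjOn (logMap k A B) unitDisk) :
    Real.exp (growthBound α 1 / k) ≤ boundaryDist (logMap k A B) := by
  -- `Metric.infDist` to the empty set is `0`, so the lower bound needs a nonempty frontier.
  have hne : (frontier (logMap k A B '' unitDisk)).Nonempty := by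
    by_contra hempty
    have h1 := frontier_eq_empty_iff.1 (Set.not_nonempty_iff_eq_empty.1 hempty)
    rcases h1 with h1 | h1
    · exact (Set.image_nonempty.2 ⟨0, zero_mem_unitDisk⟩).ne_empty h1
    · exact h.image_ne_univ hk hα₀ hinj h1
  rw [boundaryDist, logMap_eq_zero_iff.2 rfl]
  refine (Metric.le_infDist hne).2 fun w hw => ?_
  rw [dist_zero_left]
  exact h.norm_ge_of_mem_frontier hk hα₀ hα hw

end IsLogPair

/-! ### Univalence -/

namespace IsLogPair

variable {k : ℕ} {α : ℝ} {A B W : ℂ → ℂ}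

theorem exp_mem_unitDisk {s : ℂ} (hs : s.re < 0) : Complex.exp s ∈ unitDisk := by
  rw [mem_unitDisk, Complex.norm_exp]; exact Real.exp_lt_one_iff.2 hs

theorem hasStrictDerivAt_log (h : IsLogPair α A B W) {s : ℂ} (hs : s.re < 0) :
    HasStrictDerivAt (fun s => s + A (Complex.exp s) - B (Complex.exp s))
      (1 + Complex.exp s * deriv A (Complex.exp s) - Complex.exp s * deriv B (Complex.exp s))
      s := by
  have hn := unitDisk_mem_nhds (exp_mem_unitDisk hs)
  have h1 := (h.diff_A.analyticAt hn).hasStrictDerivAt.comp s (Complex.hasStrictDerivAt_exp s)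
  have h2 := (h.diff_B.analyticAt hn).hasStrictDerivAt.comp s (Complex.hasStrictDerivAt_exp s)
  refine (((hasStrictDerivAt_id s).add h1).sub h2).congr_deriv ?_
  ring

theorem hasDerivAt_log_norm (h : IsLogPair α A B W) {s : ℂ} (hs : s.re < 0) :
    HasDerivAt (fun s => s + A (Complex.exp s) + B (Complex.exp s))
      (1 + Complex.exp s * (deriv A (Complex.exp s) + deriv B (Complex.exp s))) s := by
  have hn := unitDisk_mem_nhds (exp_mem_unitDisk hs)
  have h1 := (h.diff_A.differentiableAt hn).hasDerivAt.comp s (Complex.hasDerivAt_exp s)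
  have h2 := (h.diff_B.differentiableAt hn).hasDerivAt.comp s (Complex.hasDerivAt_exp s)
  refine (((hasDerivAt_id s).add h1).add h2).congr_deriv ?_
  ring

/-- The logarithm of the starlike function `z exp (A z - B z)`, in the logarithmic coordinate, is
injective. -/
theorem injOn_log (h : IsLogPair α A B W) (hα₀ : 0 ≤ α) :
    Set.InjOn (fun s => s + A (Complex.exp s) - B (Complex.exp s)) {s | s.re < 0} := by
  intro s hs t ht hst
  by_contra hne
  have hd : t - s ≠ 0 := sub_ne_zero.2 (Ne.symm hne)
  set L := fun s => s + A (Complex.exp s) - B (Complex.exp s)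
  have hseg : ∀ x ∈ Set.Icc (0 : ℝ) 1, (s + x * (t - s)).re < 0 := fun x hx => by
    have hs' : s.re < 0 := hs
    have ht' : t.re < 0 := ht
    simp only [Complex.add_re, Complex.re_ofReal_mul, Complex.sub_re]
    rcases hx.1.eq_or_lt with h0 | h0
    · rw [← h0]; linarith
    · nlinarith [hx.2]
  -- Along the segment the derivative is `|t - s|² Re P > 0`: the Noshiro–Warschawski argument in
  -- the convex left half-plane.
  have hder : ∀ x ∈ Set.Icc (0 : ℝ) 1, ∃ d > 0,
      HasDerivAt (fun x : ℝ => (starRingEnd ℂ (t - s) * L (s + x * (t - s))).re) d x := by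
    intro x hx
    have h1 : HasDerivAt (fun x : ℂ => s + x * (t - s)) (t - s) (x : ℂ) := by
      simpa using ((hasDerivAt_id (x : ℂ)).mul_const (t - s)).const_add s
    have h2 := (((h.hasStrictDerivAt_log (hseg x hx)).hasDerivAt.comp (x : ℂ) h1).const_mul
      (starRingEnd ℂ (t - s))).real_of_complex
    refine ⟨_, ?_, h2⟩
    have h3 := h.starlike _ (exp_mem_unitDisk (hseg x hx))
    rw [mul_left_comm, mul_comm (starRingEnd ℂ _), Complex.mul_conj, Complex.re_mul_ofReal]
    exact mul_pos (by linarith) (Complex.normSq_pos.2 hd)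
  choose! d hd0 hdd using hder
  have hmono := strictMonoOn_of_hasDerivWithinAt_pos (convex_Icc (0 : ℝ) 1)
    (fun x hx => (hdd x hx).continuousAt.continuousWithinAt)
    (fun x hx => (hdd x (interior_subset hx)).hasDerivWithinAt)
    (fun x hx => hd0 x (interior_subset hx))
  have := hmono (Set.left_mem_Icc.2 zero_le_one) (Set.right_mem_Icc.2 zero_le_one) zero_lt_one
  simp only [Complex.ofReal_zero, zero_mul, add_zero, Complex.ofReal_one, one_mul,
    add_sub_cancel] at this
  rw [show L s = L t from hst] at this
  exact lt_irrefl _ this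

theorem strictMono_im_log (h : IsLogPair α A B W) (hα₀ : 0 ≤ α) {x : ℝ} (hx : x < 0) :
    StrictMono (fun y : ℝ => ((fun s => s + A (Complex.exp s) - B (Complex.exp s))
      (x + y * Complex.I)).im) := by
  have hre : ∀ y : ℝ, ((x : ℂ) + y * Complex.I).re < 0 := fun y => by simpa using hx
  have hder : ∀ y : ℝ, ∃ d > 0,
      HasDerivAt (fun y : ℝ => ((fun s => s + A (Complex.exp s) - B (Complex.exp s))
        (x + y * Complex.I)).im) d y := by
    intro y
    have h1 : HasDerivAt (fun y : ℂ => (x : ℂ) + y * Complex.I) Complex.I (y : ℂ) := by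
      simpa using ((hasDerivAt_id (y : ℂ)).mul_const Complex.I).const_add (x : ℂ)
    have h2 := (((h.hasStrictDerivAt_log (hre y)).hasDerivAt.comp (y : ℂ) h1).const_mul
      (-Complex.I)).real_of_complex
    have h3 := h.starlike _ (exp_mem_unitDisk (hre y))
    refine ⟨_, ?_, h2.congr_of_eventuallyEq (.of_forall fun y => ?_)⟩
    · rw [mul_left_comm, neg_mul, Complex.I_mul_I, neg_neg, mul_one]
      linarith
    · simp
  choose d hd0 hdd using hder
  exact strictMono_of_hasDerivAt_pos hdd hd0

/-- On a vertical line `A - B` is evaluated on one compact circle and hence bounded, so the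
imaginary part differs from `y` by a bounded amount and takes every value. -/
theorem exists_im_log_eq (h : IsLogPair α A B W) {x : ℝ} (hx : x < 0) (τ : ℝ) :
    ∃ y : ℝ, ((fun s => s + A (Complex.exp s) - B (Complex.exp s)) (x + y * Complex.I)).im = τ := by
  have hre : ∀ y : ℝ, ((x : ℂ) + y * Complex.I).re < 0 := fun y => by simpa using hx
  have hcomp := isCompact_sphere (0 : ℂ) (Real.exp x)
  have hsub : Metric.sphere (0 : ℂ) (Real.exp x) ⊆ unitDisk := fun z hz => by
    rw [mem_unitDisk, mem_sphere_zero_iff_norm.1 hz]; exact Real.exp_lt_one_iff.2 hx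
  obtain ⟨C, hC⟩ := hcomp.exists_bound_of_continuousOn
    ((h.diff_A.continuousOn.sub h.diff_B.continuousOn).mono hsub)
  have hb : ∀ y : ℝ, |(A (Complex.exp (x + y * Complex.I)) -
      B (Complex.exp (x + y * Complex.I))).im| ≤ C := fun y =>
    (Complex.abs_im_le_norm _).trans (hC _ (by
      rw [mem_sphere_zero_iff_norm, Complex.norm_exp]; simp))
  have hcont : Continuous (fun y : ℝ => ((fun s => s + A (Complex.exp s) - B (Complex.exp s))
      (x + y * Complex.I)).im) := continuous_iff_continuousAt.2 fun y =>
    Complex.continuous_im.continuousAt.comp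
      (ContinuousAt.comp (f := fun y : ℝ => (x : ℂ) + y * Complex.I)
        (h.hasStrictDerivAt_log (hre y)).hasDerivAt.continuousAt
        (Continuous.continuousAt (by fun_prop)))
  have hiv := intermediate_value_Icc (a := τ - C) (b := τ + C)
    (by linarith [(abs_nonneg _).trans (hb 0)]) hcont.continuousOn
  obtain ⟨y, -, hy⟩ := hiv (a := τ) (by
    have h1 := abs_le.1 (hb (τ - C))
    have h2 := abs_le.1 (hb (τ + C))
    simp only [Complex.sub_im] at h1 h2
    constructor
    · simp at h1 ⊢; linarith
    · simp at h2 ⊢; linarith)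
  exact ⟨y, hy⟩

/-- The image of the half-plane under the logarithm of a starlike function meets every horizontal
line in an interval. -/
theorem ordConnected_slice (h : IsLogPair α A B W) (hα₀ : 0 ≤ α) (τ : ℝ) :
    {y : ℝ | (y + τ * Complex.I : ℂ) ∈
      (fun s => s + A (Complex.exp s) - B (Complex.exp s)) '' {s | s.re < 0}}.OrdConnected := by
  set L := fun s => s + A (Complex.exp s) - B (Complex.exp s)
  have hex : ∀ x : ℝ, x < 0 → ∃ y : ℝ, (L (x + y * Complex.I)).im = τ :=
    fun x hx => h.exists_im_log_eq hx τ
  choose! T hT using hex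
  have hLc : ∀ (x y : ℝ), x < 0 → ContinuousAt (fun x : ℝ => L (x + y * Complex.I)) x := fun x y hx =>
    ContinuousAt.comp (f := fun x : ℝ => (x : ℂ) + y * Complex.I)
      (h.hasStrictDerivAt_log (s := x + y * Complex.I) (by simpa using hx)).hasDerivAt.continuousAt
      (Continuous.continuousAt (by fun_prop))
  -- Strict monotonicity in `y` turns `a < T x` into an inequality for the imaginary part at height
  -- `a`, an open condition in `x`.
  have hTc : ContinuousOn T (Set.Iio 0) := by
    refine fun x hx => ContinuousAt.continuousWithinAt (tendsto_order.2 ⟨fun a ha => ?_, fun a ha => ?_⟩)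
    · have h1 : (L (x + a * Complex.I)).im < τ := by
        rw [← hT x hx]; exact h.strictMono_im_log hα₀ hx ha
      have h2 := (Complex.continuous_im.continuousAt.comp (hLc x a hx)).eventually_lt_const h1
      filter_upwards [h2, Iio_mem_nhds hx] with x' hx' hneg
      rw [← hT x' hneg] at hx'
      exact (h.strictMono_im_log hα₀ hneg).lt_iff_lt.1 hx'
    · have h1 : τ < (L (x + a * Complex.I)).im := by
        rw [← hT x hx]; exact h.strictMono_im_log hα₀ hx ha
      have h2 := (Complex.continuous_im.continuousAt.comp (hLc x a hx)).eventually_const_lt h1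
      filter_upwards [h2, Iio_mem_nhds hx] with x' hx' hneg
      rw [← hT x' hneg] at hx'
      exact (h.strictMono_im_log hα₀ hneg).lt_iff_lt.1 hx'
  have himage : {y : ℝ | (y + τ * Complex.I : ℂ) ∈ L '' {s | s.re < 0}} =
      (fun x : ℝ => (L (x + T x * Complex.I)).re) '' Set.Iio 0 := by
    ext y
    constructor
    · rintro ⟨s, hs, hsy⟩
      have hs' : s.re < 0 := hs
      have h1 : s.im = T s.re := by
        refine (h.strictMono_im_log hα₀ hs').injective ?_
        change (L (s.re + s.im * Complex.I)).im = (L (s.re + T s.re * Complex.I)).im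
        rw [hT _ hs', Complex.re_add_im, hsy]
        simp
      refine ⟨s.re, hs', ?_⟩
      change (L (s.re + T s.re * Complex.I)).re = y
      rw [← h1, Complex.re_add_im, hsy]
      simp
    · rintro ⟨x, hx, rfl⟩
      refine ⟨x + T x * Complex.I, by simpa using hx, ?_⟩
      rw [← hT x hx, Complex.re_add_im]
  rw [himage]
  refine (isPreconnected_Iio.image _ fun x hx => ?_).ordConnected
  refine Complex.continuous_re.continuousAt.comp_continuousWithinAt ?_
  refine ContinuousAt.comp_continuousWithinAt (f := fun x : ℝ => (x : ℂ) + T x * Complex.I)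
    (h.hasStrictDerivAt_log (s := x + T x * Complex.I) (by simpa using hx)).hasDerivAt.continuousAt ?_
  have := hTc x hx
  exact (Complex.continuous_ofReal.continuousWithinAt).add
    ((Complex.continuous_ofReal.continuousAt.comp_continuousWithinAt this).mul_const _)

/-- The hypotheses say that `f` has the same argument, on a continuous branch, and the same modulus
at both points. With `M` the inverse of `L`, the function `φ` is `log|f|` on a horizontal slice of
the image of `L`. Its derivative is `Re(PQ/P) = Re Q > 0`, and the slice is an interval, so `φ` is
injective. -/
theorem eq_of_log_eq (h : IsLogPair α A B W) (hα₀ : 0 ≤ α) {s t : ℂ} (hs : s.re < 0)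
    (ht : t.re < 0)
    (him : (s + A (Complex.exp s) - B (Complex.exp s)).im =
      (t + A (Complex.exp t) - B (Complex.exp t)).im)
    (hre : (s + A (Complex.exp s) + B (Complex.exp s)).re =
      (t + A (Complex.exp t) + B (Complex.exp t)).re) : s = t := by
  set L := fun s => s + A (Complex.exp s) - B (Complex.exp s) with hL
  set S : Set ℂ := {s | s.re < 0} with hS
  have hSo : IsOpen S := isOpen_lt Complex.continuous_re continuous_const
  have hinj : Set.InjOn L S := h.injOn_log hα₀
  set M := Function.invFunOn L S with hM
  have hML : ∀ u ∈ S, M (L u) = u := fun u hu => hinj.leftInvOn_invFunOn hu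
  have hne : ∀ u ∈ S, 1 + Complex.exp u * deriv A (Complex.exp u) -
      Complex.exp u * deriv B (Complex.exp u) ≠ 0 := fun u hu h0 => by
    have h1 := h.starlike _ (exp_mem_unitDisk hu)
    rw [h0, Complex.zero_re] at h1
    linarith
  have himg : ∀ u ∈ S, ∀ V ∈ nhds u, L '' (V ∩ S) ∈ nhds (L u) := fun u hu V hV => by
    rw [← (h.hasStrictDerivAt_log hu).map_nhds_eq (hne u hu)]
    exact Filter.image_mem_map (Filter.inter_mem hV (hSo.mem_nhds hu))
  have hMc : ∀ u ∈ S, ContinuousAt M (L u) := fun u hu V hV => by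
    rw [hML u hu] at hV
    change M ⁻¹' V ∈ nhds (L u)
    filter_upwards [himg u hu V hV]
    rintro _ ⟨v, hv, rfl⟩
    rw [Set.mem_preimage, hML v hv.2]
    exact hv.1
  have hMd : ∀ u ∈ S, HasDerivAt M (1 + Complex.exp u * deriv A (Complex.exp u) -
      Complex.exp u * deriv B (Complex.exp u))⁻¹ (L u) := fun u hu => by
    refine HasDerivAt.of_local_left_inverse (f := L) (hMc u hu)
      (by rw [hML u hu]; exact (h.hasStrictDerivAt_log hu).hasDerivAt) (hne u hu) ?_
    filter_upwards [himg u hu Set.univ Filter.univ_mem]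
    rintro _ ⟨v, hv, rfl⟩
    rw [hML v hv.2]
  set τ := (L s).im with hτ
  set φ : ℝ → ℝ := fun y => (M (y + τ * Complex.I) + A (Complex.exp (M (y + τ * Complex.I))) +
    B (Complex.exp (M (y + τ * Complex.I)))).re with hφ
  set J := {y : ℝ | (y + τ * Complex.I : ℂ) ∈ L '' S}
  have hJ : J.OrdConnected := h.ordConnected_slice hα₀ τ
  have hφd : ∀ y ∈ J, ∃ d > 0, HasDerivAt φ d y := by
    rintro y ⟨u, hu, huy⟩
    have h1 : HasDerivAt (fun y : ℂ => y + τ * Complex.I) 1 (y : ℂ) :=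
      (hasDerivAt_id (y : ℂ)).add_const _
    have h2 := hMd u hu
    rw [huy] at h2
    have h3 := h2.comp (y : ℂ) h1
    have h4 : M (y + τ * Complex.I) = u := by rw [← huy, hML u hu]
    have h5 := h.hasDerivAt_log_norm hu
    rw [← h4] at h5
    have h6 := (h5.comp (y : ℂ) h3).real_of_complex
    refine ⟨_, ?_, h6⟩
    rw [h4, h.one_add_deriv_eq (exp_mem_unitDisk hu), mul_one, mul_right_comm,
      mul_inv_cancel₀ (hne u hu), one_mul]
    exact cayley_re_pos (h.norm_W_lt _ (exp_mem_unitDisk hu))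
  choose! d hd0 hdd using hφd
  have hmono := strictMonoOn_of_hasDerivWithinAt_pos hJ.convex
    (fun x hx => (hdd x hx).continuousAt.continuousWithinAt)
    (fun x hx => (hdd x (interior_subset hx)).hasDerivWithinAt)
    (fun x hx => hd0 x (interior_subset hx))
  have es : ((L s).re + τ * Complex.I : ℂ) = L s := Complex.re_add_im _
  have et : ((L t).re + τ * Complex.I : ℂ) = L t := by
    rw [hτ, show (L s).im = (L t).im from him]; exact Complex.re_add_im _
  have h1 : (L s).re = (L t).re := by
    refine hmono.injOn ⟨s, hs, es.symm⟩ ⟨t, ht, et.symm⟩ ?_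
    simp only [hφ, es, et]
    rw [hML s hs, hML t ht]
    exact hre
  exact hinj hs ht (Complex.ext h1 him)

/-- Starlike logharmonic mappings are univalent. -/
theorem injOn_logMap (h : IsLogPair α A B W) (hα₀ : 0 ≤ α) (hk : 1 ≤ k) :
    Set.InjOn (logMap k A B) unitDisk := by
  have hk' : (k : ℂ) ≠ 0 := by exact_mod_cast (by omega : k ≠ 0)
  -- The `k`-th power reduces the claim to `k = 1`; once `z^k = w^k`, the exponential factors agree
  -- and cancel.
  have hpow : ∀ z, (logMap k A B z) ^ k = logMap 1 A B (z ^ k) := fun z => by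
    simp only [logMap, mul_pow, ← map_pow, ← Complex.exp_nat_mul, pow_one, Nat.cast_one, div_one]
    rw [mul_div_cancel₀ _ hk', mul_div_cancel₀ _ hk']
  have hone : Set.InjOn (logMap 1 A B) unitDisk := by
    intro z hz w hw hzw
    by_cases hz0 : z = 0
    · rw [hz0, logMap_eq_zero_iff.2 rfl] at hzw
      rw [hz0, logMap_eq_zero_iff.1 hzw.symm]
    have hw0 : w ≠ 0 := fun hw0 => hz0 (by
      rw [hw0, logMap_eq_zero_iff.2 (rfl : (0 : ℂ) = 0)] at hzw
      exact logMap_eq_zero_iff.1 hzw)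
    have hexp : ∀ s : ℂ, logMap 1 A B (Complex.exp s) =
        Complex.exp (s + A (Complex.exp s) + starRingEnd ℂ (B (Complex.exp s))) := fun s => by
      simp [logMap, Complex.exp_add, Complex.exp_conj]
    have hlog : ∀ u : ℂ, u ≠ 0 → u ∈ unitDisk → (Complex.log u).re < 0 := fun u hu hu1 => by
      rw [Complex.log_re]
      exact Real.log_neg (norm_pos_iff.2 hu) (mem_unitDisk.1 hu1)
    rw [← Complex.exp_log hz0, ← Complex.exp_log hw0, hexp, hexp, Complex.exp_eq_exp_iff_exists_int]
      at hzw
    obtain ⟨n, hn⟩ := hzw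
    have hper : Complex.exp (Complex.log w + n * (2 * Real.pi * Complex.I)) = w := by
      rw [Complex.exp_add, Complex.exp_int_mul_two_pi_mul_I, mul_one, Complex.exp_log hw0]
    have hre : (Complex.log w + n * (2 * Real.pi * Complex.I)).re = (Complex.log w).re := by
      simp
    rw [Complex.exp_log hz0, Complex.exp_log hw0] at hn
    have h1 := congrArg Complex.re hn
    have h2 := congrArg Complex.im hn
    have := h.eq_of_log_eq hα₀ (s := Complex.log z)
      (t := Complex.log w + n * (2 * Real.pi * Complex.I)) (hlog z hz0 hz)
      (by rw [hre]; exact hlog w hw0 hw)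
      (by
        rw [hper, Complex.exp_log hz0]
        simp only [Complex.add_im, Complex.sub_im, Complex.conj_im] at h2 ⊢; linarith)
      (by
        rw [hper, Complex.exp_log hz0]
        simp only [Complex.add_re, Complex.conj_re] at h1 ⊢; linarith)
    rw [← Complex.exp_log hz0, this, hper]
  intro z hz w hw hzw
  have h1 : z ^ k = w ^ k := hone (pow_mem_unitDisk hk hz) (pow_mem_unitDisk hk hw) (by
    rw [← hpow, ← hpow, hzw])
  simp only [logMap, h1] at hzw
  simpa using hzw

end IsLogPair

/-! ### Passage between the class and pairs of logarithms -/

theorem exists_pow_eq_of_mem_unitDisk {k : ℕ} (hk : 1 ≤ k) {ζ : ℂ} (hζ : ζ ∈ unitDisk) :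
    ∃ z ∈ unitDisk, z ^ k = ζ := by
  obtain ⟨z, rfl⟩ := IsAlgClosed.exists_pow_nat_eq ζ (show 0 < k by omega)
  refine ⟨z, ?_, rfl⟩
  rw [mem_unitDisk, norm_pow] at hζ
  rw [mem_unitDisk]
  by_contra h
  exact absurd hζ (not_lt.2 (one_le_pow₀ (not_lt.1 h)))

/-- The series with the terms `a_{nk} z^{nk}`, `n ≥ 1`, as a power series in `z^k`. -/
theorem IsExpSeries.exists_hasCoeffs {k : ℕ} (hk : 1 ≤ k) {a : ℕ → ℂ} {h : ℂ → ℂ}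
    (hs : IsExpSeries k a h) :
    ∃ A : ℂ → ℂ, HasCoeffs A (fun n => if n = 0 then 0 else k * a (n * k)) ∧
      ∀ z ∈ unitDisk, h z = Complex.exp (A (z ^ k) / k) := by
  have hk' : (k : ℂ) ≠ 0 := by exact_mod_cast (by omega : k ≠ 0)
  refine ⟨fun ζ => ∑' n : ℕ, k * a ((n + 1) * k) * ζ ^ (n + 1), fun ζ hζ => ?_, fun z hz => ?_⟩
  · obtain ⟨z, hz, rfl⟩ := exists_pow_eq_of_mem_unitDisk hk hζ
    have h1 : Summable fun n : ℕ => k * a ((n + 1) * k) * (z ^ k) ^ (n + 1) := by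
      refine ((hs z hz).1.mul_left (k : ℂ)).congr fun n => ?_
      rw [← pow_mul, mul_comm k, mul_assoc]
    refine (hasSum_nat_add_iff' 1).1 ?_
    simpa using h1.hasSum
  · rw [(hs z hz).2]
    congr 1
    rw [eq_div_iff hk', ← tsum_mul_right]
    refine tsum_congr fun n => ?_
    rw [← pow_mul, mul_comm k (n + 1)]
    ring

theorem dz_congr {f g : ℂ → ℂ} (h : ∀ z ∈ unitDisk, f z = g z) {z : ℂ} (hz : z ∈ unitDisk) :
    dz f z = dz g z := by
  have : f =ᶠ[nhds z] g := Filter.eventually_of_mem (unitDisk_mem_nhds hz) h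
  rw [dz, dz, this.fderiv_eq]

theorem dzbar_congr {f g : ℂ → ℂ} (h : ∀ z ∈ unitDisk, f z = g z) {z : ℂ} (hz : z ∈ unitDisk) :
    dzbar f z = dzbar g z := by
  have : f =ᶠ[nhds z] g := Filter.eventually_of_mem (unitDisk_mem_nhds hz) h
  rw [dzbar, dzbar, this.fderiv_eq]

theorem dz_logMap_div {k : ℕ} (hk : 1 ≤ k) {A B : ℂ → ℂ} (hA : DifferentiableOn ℂ A unitDisk)
    (hB : DifferentiableOn ℂ B unitDisk) {z : ℂ} (hz : z ∈ unitDisk) (hz0 : z ≠ 0) :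
    z * (dz (logMap k A B) z / logMap k A B z) = 1 + z ^ k * deriv A (z ^ k) := by
  have hf0 : logMap k A B z ≠ 0 := fun h => hz0 (logMap_eq_zero_iff.1 h)
  rw [← mul_div_assoc, dz_logMap hk hA hB hz, mul_div_assoc, div_self hf0, mul_one]

theorem dzbar_logMap_div {k : ℕ} (hk : 1 ≤ k) {A B : ℂ → ℂ} (hA : DifferentiableOn ℂ A unitDisk)
    (hB : DifferentiableOn ℂ B unitDisk) {z : ℂ} (hz : z ∈ unitDisk) (hz0 : z ≠ 0) :
    z * (starRingEnd ℂ (dzbar (logMap k A B) z) / starRingEnd ℂ (logMap k A B z)) =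
      z ^ k * deriv B (z ^ k) := by
  have hf0 : logMap k A B z ≠ 0 := fun h => hz0 (logMap_eq_zero_iff.1 h)
  have h1 := congrArg (starRingEnd ℂ) (dzbar_logMap hk hA hB hz)
  rw [map_mul, map_mul, Complex.conj_conj, Complex.conj_conj] at h1
  rw [← mul_div_assoc, h1, mul_div_assoc, div_self (by simpa using hf0), mul_one]

theorem starlike_logMap {k : ℕ} (hk : 1 ≤ k) {A B : ℂ → ℂ} (hA : DifferentiableOn ℂ A unitDisk)
    (hB : DifferentiableOn ℂ B unitDisk) {z : ℂ} (hz : z ∈ unitDisk) (hz0 : z ≠ 0) :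
    ((z * dz (logMap k A B) z - starRingEnd ℂ z * dzbar (logMap k A B) z) / logMap k A B z).re =
      (1 + z ^ k * deriv A (z ^ k) - z ^ k * deriv B (z ^ k)).re := by
  have hf0 : logMap k A B z ≠ 0 := fun h => hz0 (logMap_eq_zero_iff.1 h)
  rw [dz_logMap hk hA hB hz, dzbar_logMap hk hA hB hz, ← sub_mul, mul_div_assoc, div_self hf0,
    mul_one, Complex.sub_re, Complex.conj_re, ← Complex.sub_re]

/-- Every mapping of the class comes from a pair of logarithms in the variable `z^k`. -/
theorem IsStarlikeLogharmonic.exists_isLogPair {k : ℕ} (hk : 1 ≤ k) {α : ℝ} (hα₀ : 0 ≤ α)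
    (hα : α < 1) {f ω h g : ℂ → ℂ} {a b : ℕ → ℂ} (hf : IsStarlikeLogharmonic k α f ω h g a b) :
    ∃ A B W : ℂ → ℂ, IsLogPair α A B W ∧
      HasCoeffs A (fun n => if n = 0 then 0 else k * a (n * k)) ∧
      HasCoeffs B (fun n => if n = 0 then 0 else k * b (n * k)) ∧
      ∀ z ∈ unitDisk, f z = logMap k A B z := by
  obtain ⟨A, hA, hAh⟩ := hf.series_h.exists_hasCoeffs hk
  obtain ⟨B, hB, hBg⟩ := hf.series_g.exists_hasCoeffs hk
  have hAd := hA.differentiableOn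
  have hBd := hB.differentiableOn
  have hfeq : ∀ z ∈ unitDisk, f z = logMap k A B z := fun z hz => by
    rw [hf.factorization z hz, hAh z hz, hBg z hz, logMap]
  have hk0 : k ≠ 0 := by omega
  have heq : ∀ z ∈ unitDisk, z ≠ 0 →
      z ^ k * deriv B (z ^ k) = ω z * (1 + z ^ k * deriv A (z ^ k)) := fun z hz hz0 => by
    have h1 := hf.logharmonic.equation z hz (by
      rw [hfeq z hz]; exact fun h => hz0 (logMap_eq_zero_iff.1 h))
    rw [dz_congr hfeq hz, dzbar_congr hfeq hz, hfeq z hz] at h1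
    rw [← dzbar_logMap_div hk hAd hBd hz hz0, ← dz_logMap_div hk hAd hBd hz hz0, h1]
    ring
  have hst : ∀ z ∈ unitDisk, z ≠ 0 →
      α < (1 + z ^ k * deriv A (z ^ k) - z ^ k * deriv B (z ^ k)).re := fun z hz hz0 => by
    have h1 := hf.starlike z hz hz0
    rwa [dz_congr hfeq hz, dzbar_congr hfeq hz, hfeq z hz, starlike_logMap hk hAd hBd hz hz0] at h1
  have hne : ∀ z ∈ unitDisk, 1 + z ^ k * deriv A (z ^ k) ≠ 0 := fun z hz h0 => by
    by_cases hz0 : z = 0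
    · simp [hz0, hk0] at h0
    · have h1 := hst z hz hz0
      rw [heq z hz hz0, h0] at h1
      simp at h1; linarith
  have hne' : ∀ ζ ∈ unitDisk, 1 + ζ * deriv A ζ ≠ 0 := fun ζ hζ => by
    obtain ⟨z, hz, rfl⟩ := exists_pow_eq_of_mem_unitDisk hk hζ
    exact hne z hz
  -- Defining `W` as this quotient makes it analytic in `ζ` at once; at `ζ = z^k ≠ 0` it equals `ω
  -- z`.
  refine ⟨A, B, fun ζ => ζ * deriv B ζ / (1 + ζ * deriv A ζ), ⟨hAd, hBd, ?_, ?_, ?_, ?_, ?_, ?_⟩,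
    hA, hB, hfeq⟩
  · have h1 := hAd.deriv isOpen_unitDisk
    have h2 := hBd.deriv isOpen_unitDisk
    exact (differentiableOn_id.mul h2).div ((differentiableOn_id.mul h1).const_add 1) hne'
  · simpa using hA.apply_zero
  · simpa using hB.apply_zero
  · intro ζ hζ
    obtain ⟨z, hz, rfl⟩ := exists_pow_eq_of_mem_unitDisk hk hζ
    by_cases hz0 : z = 0
    · simp [hz0, hk0]
    · rw [heq z hz hz0, mul_div_assoc, div_self (hne z hz), mul_one]
      exact hf.logharmonic.dilatation_lt_one z hz
  · intro ζ hζ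
    exact (div_mul_cancel₀ _ (hne' ζ hζ)).symm
  · intro ζ hζ
    obtain ⟨z, hz, rfl⟩ := exists_pow_eq_of_mem_unitDisk hk hζ
    by_cases hz0 : z = 0
    · simpa [hz0, hk0] using hα
    · exact hst z hz hz0

/-- The coefficient sequence is read only at multiples of `k`, where the division `m / k` is exact.
-/
theorem HasCoeffs.isExpSeries {k : ℕ} (hk : 1 ≤ k) {A : ℂ → ℂ} {c : ℕ → ℂ} (hA : HasCoeffs A c)
    (h0 : A 0 = 0) :
    IsExpSeries k (fun m => c (m / k) / k) (fun z => Complex.exp (A (z ^ k) / k)) := by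
  intro z hz
  have h1 := hA _ (pow_mem_unitDisk hk hz)
  have hc : c 0 = 0 := by rw [← hA.apply_zero, h0]
  have h2 : HasSum (fun n => c (n + 1) * (z ^ k) ^ (n + 1)) (A (z ^ k)) := by
    simpa [hc] using (hasSum_nat_add_iff' 1).2 h1
  have h3 : HasSum (fun n : ℕ => c ((n + 1) * k / k) / k * z ^ ((n + 1) * k)) (A (z ^ k) / k) := by
    refine (h2.div_const (k : ℂ)).congr_fun fun n => ?_
    rw [Nat.mul_div_cancel _ (by omega), ← pow_mul, mul_comm k]
    ring
  exact ⟨h3.summable, by rw [h3.tsum_eq]⟩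

/-- Every pair of logarithms gives a mapping of the class. -/
theorem IsLogPair.isStarlikeLogharmonic {k : ℕ} (hk : 1 ≤ k) {α : ℝ} (hα₀ : 0 ≤ α)
    {A B W : ℂ → ℂ} (h : IsLogPair α A B W) {c d : ℕ → ℂ} (hA : HasCoeffs A c)
    (hB : HasCoeffs B d) :
    IsStarlikeLogharmonic k α (logMap k A B) (fun z => W (z ^ k))
      (fun z => Complex.exp (A (z ^ k) / k)) (fun z => Complex.exp (B (z ^ k) / k))
      (fun m => c (m / k) / k) (fun m => d (m / k) / k) := by
  have hm : Set.MapsTo (fun z : ℂ => z ^ k) unitDisk unitDisk := fun z hz => pow_mem_unitDisk hk hz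
  have hk' : (k : ℂ) ≠ 0 := by exact_mod_cast (by omega : k ≠ 0)
  refine ⟨h.injOn_logMap hα₀ hk, ⟨h.diff_W.comp (by fun_prop) hm,
    fun z hz => h.norm_W_lt _ (hm hz), fun z hz => ?_, fun z hz hf0 => ?_⟩, fun z hz => ?_,
    fun z hz hz0 => ?_, ?_, ?_, fun z _ => rfl, hA.isExpSeries hk h.A_zero,
    hB.isExpSeries hk h.B_zero⟩
  · exact (hasStrictFDerivAt_logMap hk h.diff_A h.diff_B hz).hasFDerivAt.differentiableAt
      |>.differentiableWithinAt
  · have hz0 : z ≠ 0 := fun h => hf0 (logMap_eq_zero_iff.2 h)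
    refine mul_left_cancel₀ hz0 ?_
    rw [mul_left_comm, dzbar_logMap_div hk h.diff_A h.diff_B hz hz0,
      dz_logMap_div hk h.diff_A h.diff_B hz hz0, h.equation _ (hm hz)]
  · have : Complex.exp (2 * Real.pi * Complex.I / k) ^ k = 1 := by
      rw [← Complex.exp_nat_mul, mul_div_cancel₀ _ hk', Complex.exp_two_pi_mul_I]
    simp only [logMap, mul_pow, this, one_mul]
    ring
  · rw [starlike_logMap hk h.diff_A h.diff_B hz hz0]
    exact h.starlike _ (hm hz)
  · exact ((h.diff_A.comp (by fun_prop) hm).div_const _).cexp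
  · exact ((h.diff_B.comp (by fun_prop) hm).div_const _).cexp

/-! ### The majorant series and the radius equation -/

/-- The bound for `k` times the coefficient of index `n + 1` in the Bohr series. -/
def bohrMajorant (α : ℝ) (n : ℕ) : ℝ :=
  (2 * (1 - α) + 1 / ((n : ℝ) + 1)) + (2 * (1 - α) + (2 * α - 1) / ((n : ℝ) + 1)) +
    (2 * (1 - α) + 1 / ((n : ℝ) + 1)) * (2 * (1 - α) + (2 * α - 1) / ((n : ℝ) + 1))

/-- The sum of the series with coefficients `bohrMajorant`. -/
def bohrMajorantSum (α t : ℝ) : ℝ :=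
  4 * (1 - α) * (2 - α) * t / (1 - t) - 2 * α * (3 - 2 * α) * Real.log (1 - t) +
    (2 * α - 1) * dilog t

theorem two_mul_one_sub_add_div_nonneg {α : ℝ} (hα : α < 1) (n : ℕ) :
    0 ≤ 2 * (1 - α) + (2 * α - 1) / ((n : ℝ) + 1) := by
  have h : 0 < (n : ℝ) + 1 := by positivity
  have : 2 * (1 - α) + (2 * α - 1) / ((n : ℝ) + 1) = (2 * (1 - α) * n + 1) / ((n : ℝ) + 1) := by
    field_simp; ring
  rw [this]
  have := sub_pos.2 hα
  positivity

theorem two_mul_one_sub_add_one_div_nonneg {α : ℝ} (hα : α < 1) (n : ℕ) :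
    0 ≤ 2 * (1 - α) + 1 / ((n : ℝ) + 1) := by
  have := sub_pos.2 hα
  positivity

theorem bohrMajorant_nonneg {α : ℝ} (hα : α < 1) (n : ℕ) : 0 ≤ bohrMajorant α n := by
  have h1 := two_mul_one_sub_add_div_nonneg hα n
  have h2 := two_mul_one_sub_add_one_div_nonneg hα n
  unfold bohrMajorant
  positivity

theorem summable_dilog {t : ℝ} (h0 : 0 ≤ t) (h1 : t ≤ 1) :
    Summable fun n : ℕ => t ^ (n + 1) / ((n : ℝ) + 1) ^ 2 := by
  have hs : Summable fun n : ℕ => 1 / ((n : ℝ) + 1) ^ 2 := by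
    exact_mod_cast (summable_nat_add_iff 1).2 (Real.summable_one_div_nat_pow.2 one_lt_two)
  refine hs.of_nonneg_of_le (fun n => by positivity) fun n => ?_
  have := pow_le_one₀ (n := n + 1) h0 h1
  gcongr

/-- In powers of `1/(n + 1)` the majorant has coefficients `4(1 - α)(2 - α)`, `2α(3 - 2α)` and `2α -
1`, which give the geometric, logarithmic and dilogarithmic parts. -/
theorem hasSum_bohrMajorant (α : ℝ) {t : ℝ} (h0 : 0 ≤ t) (h1 : t < 1) :
    HasSum (fun n => bohrMajorant α n * t ^ (n + 1)) (bohrMajorantSum α t) := by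
  have s1 : HasSum (fun n : ℕ => t ^ (n + 1)) (t / (1 - t)) := by
    simpa [pow_succ', div_eq_mul_inv] using (hasSum_geometric_of_lt_one h0 h1).mul_left t
  have s2 := Real.hasSum_pow_div_log_of_abs_lt_one (x := t) (by rwa [abs_of_nonneg h0])
  have s3 : HasSum (fun n : ℕ => t ^ (n + 1) / ((n : ℝ) + 1) ^ 2) (dilog t) :=
    (summable_dilog h0 h1.le).hasSum
  have s4 := ((s1.mul_left (4 * (1 - α) * (2 - α))).add (s2.mul_left (2 * α * (3 - 2 * α)))).add
    (s3.mul_left (2 * α - 1))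
  have e : bohrMajorantSum α t = 4 * (1 - α) * (2 - α) * (t / (1 - t)) +
      2 * α * (3 - 2 * α) * -Real.log (1 - t) + (2 * α - 1) * dilog t := by
    unfold bohrMajorantSum
    ring
  rw [e]
  refine s4.congr_fun fun n => ?_
  unfold bohrMajorant
  have : (n : ℝ) + 1 ≠ 0 := by positivity
  field_simp
  ring

theorem bohrMajorantSum_mono {α : ℝ} (hα : α < 1) {s t : ℝ} (hs : 0 ≤ s) (hst : s ≤ t)
    (ht : t < 1) : bohrMajorantSum α s ≤ bohrMajorantSum α t :=
  hasSum_le (fun n => by have := bohrMajorant_nonneg hα n; gcongr)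
    (hasSum_bohrMajorant α hs (hst.trans_lt ht)) (hasSum_bohrMajorant α (hs.trans hst) ht)

theorem bohrMajorantSum_nonneg {α : ℝ} (hα : α < 1) {t : ℝ} (h0 : 0 ≤ t) (ht : t < 1) :
    0 ≤ bohrMajorantSum α t :=
  (hasSum_bohrMajorant α h0 ht).nonneg fun n =>
    mul_nonneg (bohrMajorant_nonneg hα n) (by positivity)

theorem radiusFun_eq {k : ℕ} (hk : 1 ≤ k) (α : ℝ) {r : ℝ} (h0 : 0 ≤ r) (h1 : r < 1) :
    radiusFun k α r =
      r * Real.exp (bohrMajorantSum α (r ^ k) / k) * Real.exp (-(growthBound α 1 / k)) := by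
  have hr : 0 < 1 - r ^ k := sub_pos.2 (pow_lt_one₀ h0 h1 (by omega))
  have hk' : (k : ℝ) ≠ 0 := by exact_mod_cast (by omega : k ≠ 0)
  rw [radiusFun, Real.rpow_def_of_pos two_pos, Real.rpow_def_of_pos hr, mul_div_assoc,
    ← Real.exp_sub, mul_assoc, ← Real.exp_add, mul_assoc r (Real.exp (_ / _)), ← Real.exp_add]
  congr 2
  simp only [bohrMajorantSum, growthBound]
  norm_num
  field_simp
  ring

theorem continuousOn_dilog : ContinuousOn dilog (Set.Icc 0 1) := by
  refine continuousOn_tsum (u := fun n : ℕ => 1 / ((n : ℝ) + 1) ^ 2)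
    (fun n => by fun_prop) ?_ fun n t ht => ?_
  · simpa using summable_dilog zero_le_one le_rfl
  · rw [Real.norm_of_nonneg (div_nonneg (pow_nonneg ht.1 _) (by positivity))]
    have := pow_le_one₀ (n := n + 1) ht.1 ht.2
    gcongr

/-- The closed form hides monotonicity when `2α < 1`; the series shows it, since its coefficients
are nonnegative. -/
theorem strictMonoOn_radiusFun {k : ℕ} (hk : 1 ≤ k) {α : ℝ} (hα : α < 1) :
    StrictMonoOn (radiusFun k α) (Set.Ico 0 1) := by
  intro r hr s hs hrs
  have h1 := bohrMajorantSum_mono hα (pow_nonneg hr.1 k) (pow_le_pow_left₀ hr.1 hrs.le k)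
    (pow_lt_one₀ hs.1 hs.2 (by omega))
  rw [radiusFun_eq hk α hr.1 hr.2, radiusFun_eq hk α hs.1 hs.2]
  refine mul_lt_mul_of_pos_right ?_ (Real.exp_pos _)
  exact mul_lt_mul hrs (by gcongr) (Real.exp_pos _) hs.1

theorem continuousOn_radiusFun {k : ℕ} (hk : 1 ≤ k) (α : ℝ) :
    ContinuousOn (radiusFun k α) (Set.Ico 0 1) := by
  have hpow : ∀ r ∈ Set.Ico (0 : ℝ) 1, r ^ k ∈ Set.Ico (0 : ℝ) 1 := fun r hr =>
    ⟨pow_nonneg hr.1 k, pow_lt_one₀ hr.1 hr.2 (by omega)⟩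
  have hne : ∀ r ∈ Set.Ico (0 : ℝ) 1, 1 - r ^ k ≠ 0 := fun r hr => (sub_pos.2 (hpow r hr).2).ne'
  have hd : ContinuousOn (fun r : ℝ => dilog (r ^ k)) (Set.Ico 0 1) :=
    continuousOn_dilog.comp (by fun_prop) fun r hr => Set.Ico_subset_Icc_self (hpow r hr)
  have h1 : ContinuousOn (fun r : ℝ => bohrMajorantSum α (r ^ k)) (Set.Ico 0 1) := by
    unfold bohrMajorantSum
    refine ((ContinuousOn.div (by fun_prop) (by fun_prop) hne).sub
      (continuousOn_const.mul (ContinuousOn.log (by fun_prop) hne))).add (continuousOn_const.mul hd)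
  have h2 : ContinuousOn (fun r : ℝ => r * Real.exp (bohrMajorantSum α (r ^ k) / k) *
      Real.exp (-(growthBound α 1 / k))) (Set.Ico 0 1) :=
    (continuousOn_id.mul (h1.div_const _).rexp).mul continuousOn_const
  exact h2.congr fun r hr => radiusFun_eq hk α hr.1 hr.2

theorem growthBound_one_neg {α : ℝ} (hα₀ : 0 ≤ α) (hα : α < 1) : growthBound α 1 < 0 := by
  have h := Real.log_pos one_lt_two
  unfold growthBound
  norm_num
  nlinarith

theorem exists_radius {k : ℕ} (hk : 1 ≤ k) {α : ℝ} (hα₀ : 0 ≤ α) (hα : α < 1) :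
    ∃ r ∈ Set.Ioo (0 : ℝ) 1, radiusFun k α r = 1 := by
  have hkp : (0 : ℝ) < k := by exact_mod_cast hk
  -- At `r = d` the factor `r` cancels the growth constant, leaving the exponential of a nonnegative
  -- number; so the root lies in `(0, d]`.
  set d := Real.exp (growthBound α 1 / k)
  have hd0 : 0 < d := Real.exp_pos _
  have hd1 : d < 1 := Real.exp_lt_one_iff.2 (div_neg_of_neg_of_pos (growthBound_one_neg hα₀ hα) hkp)
  have h0 : radiusFun k α 0 = 0 := by simp [radiusFun]
  have hge : 1 ≤ radiusFun k α d := by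
    rw [radiusFun_eq hk α hd0.le hd1, mul_right_comm, ← Real.exp_add, add_neg_cancel,
      Real.exp_zero, one_mul, Real.one_le_exp_iff]
    exact div_nonneg (bohrMajorantSum_nonneg hα (by positivity) (pow_lt_one₀ hd0.le hd1 (by omega)))
      hkp.le
  obtain ⟨r, hr, hr1⟩ := intermediate_value_Icc hd0.le
    ((continuousOn_radiusFun hk α).mono fun r hr => ⟨hr.1, hr.2.trans_lt hd1⟩)
    (show (1 : ℝ) ∈ Set.Icc _ _ from ⟨h0.trans_le zero_le_one, hge⟩)
  refine ⟨r, ⟨lt_of_le_of_ne hr.1 fun h => ?_, hr.2.trans_lt hd1⟩, hr1⟩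
  rw [← h, h0] at hr1
  exact zero_ne_one hr1

theorem mul_exp_bohrMajorantSum {k : ℕ} (hk : 1 ≤ k) (α : ℝ) {r : ℝ} (h0 : 0 ≤ r) (h1 : r < 1) :
    r * Real.exp (bohrMajorantSum α (r ^ k) / k) =
      radiusFun k α r * Real.exp (growthBound α 1 / k) := by
  rw [radiusFun_eq hk α h0 h1, mul_assoc _ (Real.exp (-_)), ← Real.exp_add, neg_add_cancel,
    Real.exp_zero, mul_one]

theorem bohrTerm_le {k : ℕ} (hk : 1 ≤ k) {α : ℝ} (hα : α < 1) {A B W : ℂ → ℂ} {a b : ℕ → ℂ}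
    (h : IsLogPair α A B W) (hA : HasCoeffs A (fun n => if n = 0 then 0 else k * a (n * k)))
    (hB : HasCoeffs B (fun n => if n = 0 then 0 else k * b (n * k))) (θ : ℝ) (z : ℂ) (n : ℕ) :
    bohrTerm k θ a b z n ≤ bohrMajorant α n * (‖z‖ ^ k) ^ (n + 1) / k := by
  have hkp : (0 : ℝ) < k := by exact_mod_cast hk
  have hn : (0 : ℝ) < (n : ℝ) + 1 := by positivity
  have h1 := h.coeff_A_le hα hA (Nat.succ_ne_zero n)
  have h2 := h.coeff_B_le hα hB (Nat.succ_ne_zero n)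
  simp only [Nat.succ_ne_zero, if_false, norm_mul, Complex.norm_natCast, Nat.succ_eq_add_one] at h1 h2
  push_cast at h1 h2
  set x := (k : ℝ) * ‖a ((n + 1) * k)‖ with hx
  set y := (k : ℝ) * ‖b ((n + 1) * k)‖ with hy
  have hx' : x ≤ 2 * (1 - α) + 1 / ((n : ℝ) + 1) := by
    rw [← mul_le_mul_iff_right₀ hn, mul_add, mul_one_div_cancel hn.ne']; linarith
  have hy' : y ≤ 2 * (1 - α) + (2 * α - 1) / ((n : ℝ) + 1) := by
    rw [← mul_le_mul_iff_right₀ hn, mul_add, mul_div_cancel₀ _ hn.ne']; linarith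
  have hxy : x + y + x * y ≤ bohrMajorant α n := by
    unfold bohrMajorant
    have := mul_le_mul hx' hy' (by positivity) (two_mul_one_sub_add_one_div_nonneg hα n)
    linarith
  have hnorm : ‖a ((n + 1) * k) + Complex.exp (Complex.I * θ) * b ((n + 1) * k) +
      k * a ((n + 1) * k) * b ((n + 1) * k)‖ ≤ bohrMajorant α n / k := by
    rw [le_div_iff₀ hkp]
    have e : ‖Complex.exp (Complex.I * θ)‖ = 1 := Complex.norm_exp_I_mul_ofReal θ
    have h3 := norm_add₃_le (a := a ((n + 1) * k))
      (b := Complex.exp (Complex.I * θ) * b ((n + 1) * k))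
      (c := k * a ((n + 1) * k) * b ((n + 1) * k))
    rw [norm_mul, norm_mul, norm_mul, e, Complex.norm_natCast, one_mul] at h3
    refine le_trans (mul_le_mul_of_nonneg_right h3 hkp.le) (le_trans (le_of_eq ?_) hxy)
    rw [hx, hy]; ring
  rw [bohrTerm, mul_comm (n + 1) k, pow_mul, mul_div_right_comm, mul_comm k (n + 1)]
  gcongr

theorem bohr_inequality {k : ℕ} (hk : 1 ≤ k) {α : ℝ} (hα₀ : 0 ≤ α) (hα : α < 1) {r₁ : ℝ}
    (hr : r₁ ∈ Set.Ioo (0 : ℝ) 1) (hroot : radiusFun k α r₁ = 1) {f ω h g : ℂ → ℂ} {a b : ℕ → ℂ}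
    (hf : IsStarlikeLogharmonic k α f ω h g a b) (θ : ℝ) {z : ℂ} (hz : ‖z‖ ≤ r₁) :
    Summable (bohrTerm k θ a b z) ∧
      ‖z‖ * Real.exp (∑' n : ℕ, bohrTerm k θ a b z n) ≤ boundaryDist f := by
  obtain ⟨A, B, W, hp, hA, hB, hfeq⟩ := hf.exists_isLogPair hk hα₀ hα
  have hz1 : ‖z‖ < 1 := hz.trans_lt hr.2
  have hs := (hasSum_bohrMajorant α (pow_nonneg (norm_nonneg z) k)
    (pow_lt_one₀ (norm_nonneg z) hz1 (by omega))).div_const (k : ℝ)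
  have hle := bohrTerm_le hk hα hp hA hB θ z
  have hsum : Summable (bohrTerm k θ a b z) :=
    hs.summable.of_nonneg_of_le (fun n => by unfold bohrTerm; positivity) hle
  refine ⟨hsum, ?_⟩
  have h1 : ∑' n, bohrTerm k θ a b z n ≤ bohrMajorantSum α (‖z‖ ^ k) / k :=
    hasSum_le hle hsum.hasSum hs
  have hdist : boundaryDist f = boundaryDist (logMap k A B) := by
    rw [boundaryDist, boundaryDist, hfeq 0 zero_mem_unitDisk, Set.image_congr hfeq]
  rw [hdist]
  refine le_trans ?_ (hp.le_boundaryDist hk hα₀ hα (hp.injOn_logMap hα₀ hk))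
  refine (mul_le_mul_of_nonneg_left (Real.exp_le_exp.2 h1) (norm_nonneg z)).trans ?_
  rw [mul_exp_bohrMajorantSum hk α (norm_nonneg z) hz1]
  refine mul_le_of_le_one_left (Real.exp_pos _).le ?_
  rw [← hroot]
  exact (strictMonoOn_radiusFun hk hα).monotoneOn ⟨norm_nonneg z, hz1⟩ ⟨hr.1.le, hr.2⟩ hz

/-! ### The extremal mapping -/

/-- The function `c ζ / (1 - ζ) - d log (1 - ζ)`. -/
def extremalLog (c d : ℝ) (ζ : ℂ) : ℂ := c * (ζ / (1 - ζ)) - d * Complex.log (1 - ζ)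

theorem hasCoeffs_extremalLog (c d : ℝ) :
    HasCoeffs (extremalLog c d) (fun n => if n = 0 then 0 else (c + d / n : ℂ)) := by
  intro z hz
  rw [mem_unitDisk] at hz
  have s1 : HasSum (fun n : ℕ => z ^ (n + 1)) (z / (1 - z)) := by
    simpa [pow_succ', div_eq_mul_inv] using (hasSum_geometric_of_norm_lt_one hz).mul_left z
  have s2 : HasSum (fun n : ℕ => z ^ (n + 1) / ((n + 1 : ℕ) : ℂ)) (-Complex.log (1 - z)) := by
    simpa using (hasSum_nat_add_iff' 1).2 (Complex.hasSum_taylorSeries_neg_log hz)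
  refine (hasSum_nat_add_iff' 1).1 ?_
  have s3 := (s1.mul_left (c : ℂ)).add (s2.mul_left (d : ℂ))
  have e : extremalLog c d z - ∑ i ∈ Finset.range 1,
      (fun n : ℕ => if n = 0 then 0 else (c + d / n : ℂ)) i * z ^ i =
      c * (z / (1 - z)) + d * -Complex.log (1 - z) := by
    simp [extremalLog]; ring
  rw [e]
  refine s3.congr_fun fun n => ?_
  simp; ring

theorem hasDerivAt_extremalLog (c d : ℝ) {z : ℂ} (hz : z ∈ unitDisk) :
    HasDerivAt (extremalLog c d) (c / (1 - z) ^ 2 + d / (1 - z)) z := by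
  have hz1 := mem_unitDisk.1 hz
  have hne := one_sub_ne_zero_of_norm_lt hz1
  have hslit : 1 - z ∈ Complex.slitPlane := by
    refine Or.inl ?_
    have := (Complex.abs_re_le_norm z).trans_lt hz1
    simp; exact (abs_lt.1 this).2
  have h1 : HasDerivAt (fun z : ℂ => 1 - z) (-1) z := by
    simpa using (hasDerivAt_id z).const_sub 1
  have h2 := (((hasDerivAt_id z).div h1 hne).const_mul (c : ℂ)).sub
    ((h1.clog hslit).const_mul (d : ℂ))
  refine h2.congr_deriv ?_
  simp only [id]
  field_simp
  ring

theorem re_div_one_sub_gt {z : ℂ} (hz : z ∈ unitDisk) : -1 / 2 < (z / (1 - z)).re := by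
  have h1 := mem_unitDisk.1 hz
  have h2 := cayley_re_pos h1
  have e : (1 + z) / (1 - z) = 1 + (2 : ℝ) * (z / (1 - z)) := by
    have := one_sub_ne_zero_of_norm_lt h1
    push_cast
    field_simp; ring
  rw [e, Complex.add_re, Complex.re_ofReal_mul, Complex.one_re] at h2
  linarith

/-- Chosen so that `W` is the identity and `P = 1 + 2(1 - α)z/(1 - z)` maps onto the half-plane `Re
> α`, which makes the bounds of `coeff_A_le` and `coeff_B_le` equalities. -/
theorem isLogPair_extremal {α : ℝ} (hα : α < 1) :
    IsLogPair α (extremalLog (2 * (1 - α)) 1) (extremalLog (2 * (1 - α)) (2 * α - 1)) id := by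
  have hne : ∀ z ∈ unitDisk, (1 : ℂ) - z ≠ 0 := fun z hz =>
    one_sub_ne_zero_of_norm_lt (mem_unitDisk.1 hz)
  refine ⟨(hasCoeffs_extremalLog _ _).differentiableOn, (hasCoeffs_extremalLog _ _).differentiableOn,
    differentiableOn_id, by simp [extremalLog], by simp [extremalLog],
    fun z hz => mem_unitDisk.1 hz, fun z hz => ?_, fun z hz => ?_⟩
  · rw [(hasDerivAt_extremalLog _ _ hz).deriv, (hasDerivAt_extremalLog _ _ hz).deriv]
    have := hne z hz
    push_cast
    simp only [id]
    field_simp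
    ring
  · rw [(hasDerivAt_extremalLog _ _ hz).deriv, (hasDerivAt_extremalLog _ _ hz).deriv]
    have h1 := re_div_one_sub_gt hz
    have e : (1 : ℂ) + z * (((2 * (1 - α) : ℝ) : ℂ) / (1 - z) ^ 2 + (1 : ℝ) / (1 - z)) -
        z * (((2 * (1 - α) : ℝ) : ℂ) / (1 - z) ^ 2 + ((2 * α - 1 : ℝ) : ℂ) / (1 - z)) =
        1 + ((2 * (1 - α) : ℝ) : ℂ) * (z / (1 - z)) := by
      have := hne z hz
      push_cast
      field_simp
      ring
    rw [e, Complex.add_re, Complex.re_ofReal_mul, Complex.one_re]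
    nlinarith

theorem boundaryDist_extremal_le {k : ℕ} (hk : 1 ≤ k) {α : ℝ} (hα₀ : 0 ≤ α) (hα : α < 1) :
    boundaryDist (logMap k (extremalLog (2 * (1 - α)) 1) (extremalLog (2 * (1 - α)) (2 * α - 1))) ≤
      Real.exp (growthBound α 1 / k) := by
  have hp := isLogPair_extremal hα
  set A := extremalLog (2 * (1 - α)) 1 with hA
  set B := extremalLog (2 * (1 - α)) (2 * α - 1) with hB
  have hk' : (k : ℂ) ≠ 0 := by exact_mod_cast (by omega : k ≠ 0)
  -- The point over `ζ = -1`, where the extremal logarithms stay continuous and the growth bound is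
  -- attained.
  set z₁ := Complex.exp ((Real.pi / k : ℝ) * Complex.I) with hz₁
  have hpow : z₁ ^ k = -1 := by
    rw [hz₁, ← Complex.exp_nat_mul, ← Complex.exp_pi_mul_I]
    congr 1
    push_cast
    field_simp
  have hnorm : ‖z₁‖ = 1 := Complex.norm_exp_ofReal_mul_I _
  have hcont : ∀ c d : ℝ, ContinuousAt (extremalLog c d) (z₁ ^ k) := fun c d => by
    rw [hpow]
    have h1 : ContinuousAt (fun z : ℂ => 1 - z) (-1) := by fun_prop
    refine ((continuousAt_id.div h1 (by norm_num)).const_mul _).sub ((h1.clog ?_).const_mul _)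
    left; norm_num
  have hcont' : ContinuousAt (logMap k A B) z₁ := by
    have hpc : ContinuousAt (fun z : ℂ => z ^ k) z₁ := by fun_prop
    have h1 : ContinuousAt (fun z => A (z ^ k)) z₁ :=
      ContinuousAt.comp (f := fun z : ℂ => z ^ k) (hcont _ _) hpc
    have h2 : ContinuousAt (fun z => B (z ^ k)) z₁ :=
      ContinuousAt.comp (f := fun z : ℂ => z ^ k) (hcont _ _) hpc
    exact (continuousAt_id.mul (h1.div_const _).cexp).mul
      (Complex.continuous_conj.continuousAt.comp (h2.div_const _).cexp)
  have hcl : z₁ ∈ closure unitDisk := by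
    rw [unitDisk, closure_ball _ one_ne_zero]; simp [hnorm]
  have hfr : logMap k A B z₁ ∈ frontier (logMap k A B '' unitDisk) := by
    rw [(hp.isOpen_image hk hα₀ isOpen_unitDisk le_rfl).frontier_eq]
    refine ⟨hcont'.continuousWithinAt.mem_closure_image hcl, ?_⟩
    rintro ⟨z₀, hz₀, heq⟩
    -- If the value at `z₁` were also taken inside, points of the disk near `z₁` would have values
    -- in `U` and thus modulus below `R < 1`.
    obtain ⟨R, hR, U, hU, hRU⟩ := hp.exists_norm_lt_of_near_value hk hα₀ (hp.injOn_logMap hα₀ hk) hz₀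
    rw [heq] at hU
    have : (nhdsWithin z₁ unitDisk).NeBot := mem_closure_iff_nhdsWithin_neBot.1 hcl
    have h1 : ∀ᶠ z in nhdsWithin z₁ unitDisk, logMap k A B z ∈ U :=
      (hcont'.tendsto.mono_left nhdsWithin_le_nhds) hU
    have h2 : ∀ᶠ z in nhdsWithin z₁ unitDisk, R < ‖z‖ :=
      ((continuous_norm.tendsto z₁).mono_left nhdsWithin_le_nhds).eventually_const_lt (by rwa [hnorm])
    obtain ⟨z, ⟨h3, h4⟩, h5⟩ := ((h1.and h2).and self_mem_nhdsWithin).exists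
    exact absurd (hRU z h5 h3) (not_lt.2 h4.le)
  rw [boundaryDist, logMap_eq_zero_iff.2 rfl]
  refine (Metric.infDist_le_dist_of_mem hfr).trans_eq ?_
  rw [dist_zero_left, norm_logMap, hnorm, one_mul, hpow]
  congr 2
  have hlog : (Complex.log (1 - -1)).re = Real.log 2 := by
    rw [Complex.log_re]; norm_num
  have hdiv : ((-1 : ℂ) / (1 - -1)) = ((-1 / 2 : ℝ) : ℂ) := by push_cast; norm_num
  simp only [hA, hB, extremalLog, Complex.add_re, Complex.sub_re, Complex.re_ofReal_mul, hlog, hdiv,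
    Complex.ofReal_re, growthBound]
  norm_num
  ring

/-- With `θ = 0` all three summands in the norm are nonnegative reals, so the triangle inequality
loses nothing and each term equals its majorant. -/
theorem hasSum_bohrTerm_extremal {k : ℕ} (hk : 1 ≤ k) {α : ℝ} (hα : α < 1) {r : ℝ} (h0 : 0 ≤ r)
    (h1 : r < 1) :
    HasSum (bohrTerm k 0
      (fun m => (if m / k = 0 then 0 else (((2 * (1 - α) : ℝ) : ℂ) + (1 : ℝ) / (m / k : ℕ))) / k)
      (fun m => (if m / k = 0 then 0 else (((2 * (1 - α) : ℝ) : ℂ) + (2 * α - 1 : ℝ) / (m / k : ℕ)))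
        / k) r)
      (bohrMajorantSum α (r ^ k) / k) := by
  have hk' : (k : ℂ) ≠ 0 := by exact_mod_cast (by omega : k ≠ 0)
  refine ((hasSum_bohrMajorant α (pow_nonneg h0 k) (pow_lt_one₀ h0 h1 (by omega))).div_const
    (k : ℝ)).congr_fun fun n => ?_
  have hn : (n + 1) * k / k = n + 1 := Nat.mul_div_cancel _ (by omega)
  simp only [bohrTerm, hn, Nat.succ_ne_zero, if_false]
  have e : (((2 * (1 - α) : ℝ) : ℂ) + (1 : ℝ) / ((n + 1 : ℕ) : ℂ)) / k +
      Complex.exp (Complex.I * (0 : ℝ)) *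
        ((((2 * (1 - α) : ℝ) : ℂ) + (2 * α - 1 : ℝ) / ((n + 1 : ℕ) : ℂ)) / k) +
      k * ((((2 * (1 - α) : ℝ) : ℂ) + (1 : ℝ) / ((n + 1 : ℕ) : ℂ)) / k) *
        ((((2 * (1 - α) : ℝ) : ℂ) + (2 * α - 1 : ℝ) / ((n + 1 : ℕ) : ℂ)) / k) =
      ((bohrMajorant α n / k : ℝ) : ℂ) := by
    simp only [Complex.ofReal_zero, mul_zero, Complex.exp_zero, one_mul]
    unfold bohrMajorant
    push_cast
    field_simp
  rw [e, Complex.norm_real, Complex.norm_real, Real.norm_of_nonneg h0, Real.norm_of_nonneg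
    (div_nonneg (bohrMajorant_nonneg hα n) (Nat.cast_nonneg k)), mul_comm (n + 1) k, pow_mul]
  ring

end

theorem mainTheorem2 (k : ℕ) (hk : 1 ≤ k) (α : ℝ) (hα₀ : 0 ≤ α) (hα₁ : α < 1) :
    ∃ r₁ : ℝ,
      -- `r₁` is the unique root in `(0, 1)`
      (r₁ ∈ Set.Ioo (0 : ℝ) 1 ∧ radiusFun k α r₁ = 1 ∧
        ∀ r ∈ Set.Ioo (0 : ℝ) 1, radiusFun k α r = 1 → r = r₁) ∧
      -- the inequality holds for `|z| ≤ r₁`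
      (∀ (f ω h g : ℂ → ℂ) (a b : ℕ → ℂ),
        IsStarlikeLogharmonic k α f ω h g a b → ω 0 = 0 →
        ∀ (θ : ℝ) (z : ℂ), ‖z‖ ≤ r₁ →
          Summable (bohrTerm k θ a b z) ∧
          ‖z‖ * Real.exp (∑' n : ℕ, bohrTerm k θ a b z n) ≤ boundaryDist f) ∧
      -- `r₁` is best possible: for one function of the class and `θ = 0`, the inequality fails
      -- on every circle `|z| = r` with `r₁ < r < 1`
      (∃ (f ω h g : ℂ → ℂ) (a b : ℕ → ℂ),
        IsStarlikeLogharmonic k α f ω h g a b ∧ ω 0 = 0 ∧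
        ∀ r ∈ Set.Ioo r₁ 1, ∃ z : ℂ, ‖z‖ = r ∧
          Summable (bohrTerm k 0 a b z) ∧
          boundaryDist f < ‖z‖ * Real.exp (∑' n : ℕ, bohrTerm k 0 a b z n)) := by
  obtain ⟨r₁, hr₁, hroot⟩ := exists_radius hk hα₀ hα₁
  have hmono := strictMonoOn_radiusFun hk hα₁
  refine ⟨r₁, ⟨hr₁, hroot, fun r hr h => ?_⟩, fun f ω h g a b hf _ θ z hz =>
    bohr_inequality hk hα₀ hα₁ hr₁ hroot hf θ hz, ?_⟩
  · exact hmono.injOn ⟨hr.1.le, hr.2⟩ ⟨hr₁.1.le, hr₁.2⟩ (h.trans hroot.symm)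
  refine ⟨_, _, _, _, _, _, (isLogPair_extremal hα₁).isStarlikeLogharmonic hk hα₀
    (hasCoeffs_extremalLog _ _) (hasCoeffs_extremalLog _ _), by simp; omega, fun r hr => ?_⟩
  have hr0 : 0 ≤ r := hr₁.1.le.trans hr.1.le
  have hs := hasSum_bohrTerm_extremal hk hα₁ hr0 hr.2
  have hn : ‖(r : ℂ)‖ = r := by rw [Complex.norm_real, Real.norm_of_nonneg hr0]
  refine ⟨r, hn, hs.summable, (boundaryDist_extremal_le hk hα₀ hα₁).trans_lt ?_⟩
  rw [hn, hs.tsum_eq, mul_exp_bohrMajorantSum hk α hr0 hr.2]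
  refine lt_mul_of_one_lt_left (Real.exp_pos _) ?_
  rw [← hroot]
  exact hmono ⟨hr₁.1.le, hr₁.2⟩ ⟨hr0, hr.2⟩ hr.1
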